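/- **Setting.** An indefinite Kähler manifold $(M,g,J)$ of real dimension $2n$ is a smooth manifold with a smooth nondegenerate symmetric metric $g$ that is indefinite at every point, and a smooth almost complex structure $J$ ($J^2=-1$) with $g(Jx,Jy)=g(x,y)$ and $\nabla J=0$ for the Levi-Civita connection $\nabla$ of $g$. Let $R(x,y,z,u)=g(R(x,y)z,u)$, with $R(x,y)=[\nabla_x,\nabla_y]-\nabla_{[x,y]}$, be the curvature tensor, $S(y,z)=\operatorname{tr}(x\mapsto R(x,y)z)$ the Ricci tensor and $\tau$ the scalar curvature. For $x\in T_pM$ with $g(x,x)\neq 0$ let $$H(x)=\frac{R(x,Jx,Jx,x)}{g(x,x)^2}$$ be the holomorphic sectional curvature. $M$ is of constant holomorphic sectional curvature at $p$ if $H$ is constant on $\{x\in T_pM: g(x,x)\ne0\}$. A vector $\xi\neq 0$ is isotropic if $g(\xi,\xi)=0$. A real $2$-plane $\alpha\subset T_pM$ is holomorphic if $J\alpha=\alpha$. The Bochner curvature tensor is $$B=R-\frac{1}{2(n+2)}(\varphi+\psi)(S)+\frac{\tau}{4(n+1)(n+2)}(\pi_1+\pi_2),$$ where, for a symmetric bilinear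 form $Q$, $$\varphi(Q)(x,y,z,u)=g(x,u)Q(y,z)-g(x,z)Q(y,u)+g(y,z)Q(x,u)-g(y,u)Q(x,z),$$ $$\psi(Q)(x,y,z,u)=g(x,Ju)Q(y,Jz)-g(x,Jz)Q(y,Ju)-2g(x,Jy)Q(z,Ju)+g(y,Jz)Q(x,Ju)-g(y,Ju)Q(x,Jz)-2g(z,Ju)Q(x,Jy),$$ $$\pi_1(x,y,z,u)=g(x,u)g(y,z)-g(x,z)g(y,u),\qquad \pi_2=\tfrac12\psi(g).$$ **Corollary.** Let $(M,g,J)$ and $(\overline M,\bar g,\overline J)$ be indefinite Kähler manifolds of dimension $2n\ge 4$, $M$ connected, and let $f:M\to\overline M$ be a (smooth) diffeomorphism whose differential maps every holomorphic $2$-plane onto a holomorphic $2$-plane. Suppose that for every $p\in M$ and every isotropic vector $\xi\in T_pM$ $$\lim_{x\to\xi}\frac{\overline H(f_*x)}{H(x)}=1,$$ where $x\in T_pM$ runs through the vectors for which the quotient is defined, i.e. $g(x,x)\ne0$, $\bar g(f_*x,f_*x)\neq 0$ and $H(x)\ne 0$ (the condition is vacuous if $\xi$ is not a limit of such vectors).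 Suppose further that $M$ is nowhere of constant holomorphic sectional curvature, in the sense that the set of points $p\in M$ at which $M$ is not of constant holomorphic sectional curvature is dense in $M$. If the Bochner curvature tensor of $M$ is not identically zero, then $f$ is holomorphic ($f_*J=\overline Jf_*$) or antiholomorphic ($f_*J=-\overline Jf_*$), and $f$ is an isometry: $f^*\bar g=g$. -/

import Mathlib

open Set Filter Topology Bundle
open scoped Manifold ContDiff

noncomputable section

/-! ### Levi-Civita calculus on a vector space `E`

Here `G : E → E →L[ℝ] E →L[ℝ] ℝ` is a field of symmetric bilinear forms on (an open part of) `E`. -/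

namespace LocalGeometry

variable {E : Type*} [NormedAddCommGroup E] [NormedSpace ℝ E]

/-- The Christoffel symbol of the first kind: `christoffelLower G y u v` is the linear form
`w ↦ ½ (∂ᵤ G(v, w) + ∂ᵥ G(u, w) - ∂_w G(u, v))` at the point `y`. -/
def christoffelLower (G : E → E →L[ℝ] E →L[ℝ] ℝ) (y u v : E) : E →L[ℝ] ℝ :=
  (1 / 2 : ℝ) • (fderiv ℝ G y u v + fderiv ℝ G y v u - ((fderiv ℝ G y).flip u).flip v)

theorem christoffelLower_apply (G : E → E →L[ℝ] E →L[ℝ] ℝ) (y u v w : E) :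
    christoffelLower G y u v w =
      1 / 2 * (fderiv ℝ G y u v w + fderiv ℝ G y v u w - fderiv ℝ G y w u v) := by
  simp [christoffelLower]

/-- The Christoffel symbol of the second kind, `Γ(u, v)` at the point `y`: the vector which
represents the form `christoffelLower G y u v` with respect to the nondegenerate form `G y`. -/
def christoffel (G : E → E →L[ℝ] E →L[ℝ] ℝ) (y u v : E) : E :=
  (G y).inverse (christoffelLower G y u v)

/-- The curvature operator `R(u, v) = [∇ᵤ, ∇ᵥ] - ∇_[u, v]` of the Levi-Civita connection of `G` at
the point `y`: `R(u, v) w = ∂ᵤΓ(v, w) - ∂ᵥΓ(u, w) + Γ(u, Γ(v, w)) - Γ(v, Γ(u, w))`. -/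
def curvature (G : E → E →L[ℝ] E →L[ℝ] ℝ) (y u v w : E) : E :=
  fderiv ℝ (fun z => christoffel G z v w) y u - fderiv ℝ (fun z => christoffel G z u w) y v
    + christoffel G y u (christoffel G y v w) - christoffel G y v (christoffel G y u w)

/-- The covariant derivative of a field of endomorphisms,
`(∇ᵤ A) v = (∂ᵤ A) v + Γ(u, A v) - A Γ(u, v)` at the point `y`. -/
def covDerivEnd (G : E → E →L[ℝ] E →L[ℝ] ℝ) (A : E → E →L[ℝ] E) (y u v : E) : E :=
  fderiv ℝ A y u v + christoffel G y u (A y v) - A y (christoffel G y u v)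

variable [FiniteDimensional ℝ E]

/-- The Ricci tensor `S(v, w) = tr (u ↦ R(u, v) w)`, the trace being written in a basis `e` of `E`
with dual basis `ε`: `S(v, w) = ∑ᵢ εⁱ(R(eᵢ, v) w)`. -/
def ricci (G : E → E →L[ℝ] E →L[ℝ] ℝ) (y v w : E) : ℝ :=
  ∑ i, (Module.finBasis ℝ E).coord i (curvature G y (Module.finBasis ℝ E i) v w)

/-- The scalar curvature, the trace of the Ricci tensor with respect to `G`: in a basis `e` with dual
basis `ε` it is `∑ᵢ S(G⁻¹ εⁱ, eᵢ) = ∑ᵢⱼ Gⁱʲ Sᵢⱼ`. -/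
def scalar (G : E → E →L[ℝ] E →L[ℝ] ℝ) (y : E) : ℝ :=
  ∑ i, ricci G y
    ((G y).inverse (LinearMap.toContinuousLinearMap ((Module.finBasis ℝ E).coord i)))
    (Module.finBasis ℝ E i)

end LocalGeometry

/-! ### Tensor fields in charts -/

section Charts

variable {E : Type*} [NormedAddCommGroup E] [NormedSpace ℝ E]
  {M : Type*} [TopologicalSpace M] [ChartedSpace E M]

/-- The components, in the chart at `p`, of a field `g` of bilinear forms on the tangent spaces:
the pull-back of `g` by the inverse of the chart. -/
def bilinInChart
    (g : ∀ q : M, TangentSpace 𝓘(ℝ, E) q →L[ℝ] TangentSpace 𝓘(ℝ, E) q →L[ℝ] ℝ) (p : M) (y : E) :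
    E →L[ℝ] E →L[ℝ] ℝ :=
  let D : E →L[ℝ] E := mfderiv 𝓘(ℝ, E) 𝓘(ℝ, E) (extChartAt 𝓘(ℝ, E) p).symm y
  let b : E →L[ℝ] E →L[ℝ] ℝ := g ((extChartAt 𝓘(ℝ, E) p).symm y)
  b.bilinearComp D D

/-- The components, in the chart at `p`, of a field `A` of endomorphisms of the tangent spaces. -/
def endInChart
    (A : ∀ q : M, TangentSpace 𝓘(ℝ, E) q →L[ℝ] TangentSpace 𝓘(ℝ, E) q) (p : M) (y : E) :
    E →L[ℝ] E :=
  let D : E →L[ℝ] E := mfderiv 𝓘(ℝ, E) 𝓘(ℝ, E) (extChartAt 𝓘(ℝ, E) p).symm y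
  let D' : E →L[ℝ] E :=
    mfderiv 𝓘(ℝ, E) 𝓘(ℝ, E) (extChartAt 𝓘(ℝ, E) p) ((extChartAt 𝓘(ℝ, E) p).symm y)
  let a : E →L[ℝ] E := A ((extChartAt 𝓘(ℝ, E) p).symm y)
  D'.comp (a.comp D)

end Charts

/-! ### Indefinite Kähler manifolds -/

/-- An indefinite Kähler structure on a smooth manifold `M` modelled on `E`: a smooth pseudo-Riemannian
metric `g` which is indefinite at every point, and a smooth almost complex structure `J` which is
orthogonal for `g` and parallel for the Levi-Civita connection of `g`. -/
structure IndefiniteKaehler (E : Type*) [NormedAddCommGroup E] [NormedSpace ℝ E]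
    (M : Type*) [TopologicalSpace M] [ChartedSpace E M] [IsManifold 𝓘(ℝ, E) ∞ M] where
  /-- the metric -/
  g : ∀ p : M, TangentSpace 𝓘(ℝ, E) p →L[ℝ] TangentSpace 𝓘(ℝ, E) p →L[ℝ] ℝ
  /-- the almost complex structure -/
  J : ∀ p : M, TangentSpace 𝓘(ℝ, E) p →L[ℝ] TangentSpace 𝓘(ℝ, E) p
  g_smooth : ContMDiff 𝓘(ℝ, E) (𝓘(ℝ, E).prod 𝓘(ℝ, E →L[ℝ] E →L[ℝ] ℝ)) ∞
    (fun p ↦ TotalSpace.mk' (E →L[ℝ] E →L[ℝ] ℝ)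
      (E := fun q : M ↦ TangentSpace 𝓘(ℝ, E) q →L[ℝ] TangentSpace 𝓘(ℝ, E) q →L[ℝ] ℝ) p (g p))
  J_smooth : ContMDiff 𝓘(ℝ, E) (𝓘(ℝ, E).prod 𝓘(ℝ, E →L[ℝ] E)) ∞
    (fun p ↦ TotalSpace.mk' (E →L[ℝ] E)
      (E := fun q : M ↦ TangentSpace 𝓘(ℝ, E) q →L[ℝ] TangentSpace 𝓘(ℝ, E) q) p (J p))
  g_symm : ∀ (p : M) (x y : TangentSpace 𝓘(ℝ, E) p), g p x y = g p y x
  g_nondegenerate : ∀ (p : M) (x : TangentSpace 𝓘(ℝ, E) p), (∀ y, g p x y = 0) → x = 0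
  g_indefinite : ∀ p : M, (∃ x, 0 < g p x x) ∧ (∃ x, g p x x < 0)
  J_sq : ∀ (p : M) (x : TangentSpace 𝓘(ℝ, E) p), J p (J p x) = -x
  J_orthogonal : ∀ (p : M) (x y : TangentSpace 𝓘(ℝ, E) p), g p (J p x) (J p y) = g p x y
  /-- `∇J = 0`, expressed at every point of every chart -/
  J_parallel : ∀ (p : M), ∀ y ∈ (extChartAt 𝓘(ℝ, E) p).target, ∀ u v : E,
    LocalGeometry.covDerivEnd (bilinInChart g p) (endInChart J p) y u v = 0

namespace IndefiniteKaehler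

variable {E : Type*} [NormedAddCommGroup E] [NormedSpace ℝ E]
  {M : Type*} [TopologicalSpace M] [ChartedSpace E M] [IsManifold 𝓘(ℝ, E) ∞ M]
  (K : IndefiniteKaehler E M)

/-- The metric in the chart at `p`. -/
def gChart (p : M) : E → E →L[ℝ] E →L[ℝ] ℝ := bilinInChart K.g p

/-- The curvature tensor `R(x, y, z, u) = g(R(x, y) z, u)` at `p`. It is computed in the chart at `p`;
`TangentSpace 𝓘(ℝ, E) p` is by definition `E`, a vector being identified with its components in
this chart. -/
def R (p : M) (x y z u : TangentSpace 𝓘(ℝ, E) p) : ℝ :=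
  K.g p (LocalGeometry.curvature (E := E) (K.gChart p) (extChartAt 𝓘(ℝ, E) p p) x y z) u

/-- The Ricci tensor at `p`. -/
def S [FiniteDimensional ℝ E] (p : M) (x y : TangentSpace 𝓘(ℝ, E) p) : ℝ :=
  LocalGeometry.ricci (E := E) (K.gChart p) (extChartAt 𝓘(ℝ, E) p p) x y

/-- The scalar curvature at `p`. -/
def scal [FiniteDimensional ℝ E] (p : M) : ℝ :=
  LocalGeometry.scalar (K.gChart p) (extChartAt 𝓘(ℝ, E) p p)

/-- The tensor `φ(Q)` for a bilinear form `Q` on the tangent space at `p`. -/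
def phi (p : M) (Q : TangentSpace 𝓘(ℝ, E) p → TangentSpace 𝓘(ℝ, E) p → ℝ)
    (x y z u : TangentSpace 𝓘(ℝ, E) p) : ℝ :=
  K.g p x u * Q y z - K.g p x z * Q y u + K.g p y z * Q x u - K.g p y u * Q x z

/-- The tensor `ψ(Q)` for a bilinear form `Q` on the tangent space at `p`. -/
def psi (p : M) (Q : TangentSpace 𝓘(ℝ, E) p → TangentSpace 𝓘(ℝ, E) p → ℝ)
    (x y z u : TangentSpace 𝓘(ℝ, E) p) : ℝ :=
  K.g p x (K.J p u) * Q y (K.J p z) - K.g p x (K.J p z) * Q y (K.J p u)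
    - 2 * K.g p x (K.J p y) * Q z (K.J p u)
    + K.g p y (K.J p z) * Q x (K.J p u) - K.g p y (K.J p u) * Q x (K.J p z)
    - 2 * K.g p z (K.J p u) * Q x (K.J p y)

/-- The tensor `π₁`. -/
def pi1 (p : M) (x y z u : TangentSpace 𝓘(ℝ, E) p) : ℝ :=
  K.g p x u * K.g p y z - K.g p x z * K.g p y u

/-- The tensor `π₂ = ½ ψ(g)`. -/
def pi2 (p : M) (x y z u : TangentSpace 𝓘(ℝ, E) p) : ℝ :=
  1 / 2 * K.psi p (fun a b => K.g p a b) x y z u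

/-- The Bochner curvature tensor at `p`; here `n` is the complex dimension, `dim M = 2n`. -/
def bochner [FiniteDimensional ℝ E] (p : M) (x y z u : TangentSpace 𝓘(ℝ, E) p) : ℝ :=
  let n : ℝ := (Module.finrank ℝ E : ℝ) / 2
  K.R p x y z u
    - 1 / (2 * (n + 2)) * (K.phi p (K.S p) x y z u + K.psi p (K.S p) x y z u)
    + K.scal p / (4 * (n + 1) * (n + 2)) * (K.pi1 p x y z u + K.pi2 p x y z u)

/-- The sectional curvature of the nondegenerate plane spanned by `x` and `y`. -/
def sectional (p : M) (x y : TangentSpace 𝓘(ℝ, E) p) : ℝ :=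
  K.R p x y y x / K.pi1 p x y y x

/-- The holomorphic sectional curvature: the curvature of the plane spanned by `x` and `J x`, for a
vector `x` with `g(x, x) ≠ 0`. -/
def holSectional (p : M) (x : TangentSpace 𝓘(ℝ, E) p) : ℝ :=
  K.sectional p x (K.J p x)

/-- At the point `p` all nondegenerate holomorphic planes have the same curvature. -/
def HasConstHolSectionalAt (p : M) : Prop :=
  ∃ c : ℝ, ∀ x : TangentSpace 𝓘(ℝ, E) p, K.g p x x ≠ 0 → K.holSectional p x = c

/-- A tangent vector is isotropic if it is nonzero and `g(ξ, ξ) = 0`. -/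
def IsIsotropic (p : M) (ξ : TangentSpace 𝓘(ℝ, E) p) : Prop :=
  ξ ≠ 0 ∧ K.g p ξ ξ = 0

/-- The plane (real subspace of dimension two) spanned by `x ≠ 0` and `J x`; these are the holomorphic
planes, degenerate ones included. -/
def holPlane (p : M) (x : TangentSpace 𝓘(ℝ, E) p) : Submodule ℝ (TangentSpace 𝓘(ℝ, E) p) :=
  Submodule.span ℝ {x, K.J p x}

end IndefiniteKaehler

section Maps

variable {E : Type*} [NormedAddCommGroup E] [NormedSpace ℝ E]
  {M : Type*} [TopologicalSpace M] [ChartedSpace E M] [IsManifold 𝓘(ℝ, E) ∞ M]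
  {M' : Type*} [TopologicalSpace M'] [ChartedSpace E M'] [IsManifold 𝓘(ℝ, E) ∞ M']

/-- The differential `f_*` at `p`. -/
abbrev push (f : M → M') (p : M) : TangentSpace 𝓘(ℝ, E) p →L[ℝ] TangentSpace 𝓘(ℝ, E) (f p) :=
  mfderiv 𝓘(ℝ, E) 𝓘(ℝ, E) f p

/-- The image of every holomorphic plane is holomorphic, that is, invariant under `J`. -/
def PreservesHolPlanes (K : IndefiniteKaehler E M) (K' : IndefiniteKaehler E M') (f : M → M') :
    Prop :=
  ∀ (p : M) (x : TangentSpace 𝓘(ℝ, E) p), x ≠ 0 →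
    ((K.holPlane p x).map (push f p).toLinearMap).map (K'.J (f p)).toLinearMap =
      (K.holPlane p x).map (push f p).toLinearMap

/-- The limit condition `lim_{x → ξ} H'(f_* x) / H(x) = 1`: the vector `x` approaches `ξ` in the
tangent space at `p`, through the vectors for which the quotient is defined, that is,
`x` and `f_* x` are not isotropic and `H(x) ≠ 0`. -/
def HolCurvatureRatioTendsToOne (K : IndefiniteKaehler E M) (K' : IndefiniteKaehler E M')
    (f : M → M') (p : M) (ξ : TangentSpace 𝓘(ℝ, E) p) : Prop :=
  Tendsto (fun x : TangentSpace 𝓘(ℝ, E) p =>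
      K'.holSectional (f p) (push f p x) / K.holSectional p x)
    (𝓝[{x | K.g p x x ≠ 0 ∧ K'.g (f p) (push f p x) (push f p x) ≠ 0 ∧
      K.holSectional p x ≠ 0}] ξ) (𝓝 1)

/-- `f` is holomorphic: `f_* ∘ J = J' ∘ f_*`. -/
def IsHolomorphicMap (K : IndefiniteKaehler E M) (K' : IndefiniteKaehler E M') (f : M → M') :
    Prop :=
  ∀ (p : M) (x : TangentSpace 𝓘(ℝ, E) p), push f p (K.J p x) = K'.J (f p) (push f p x)

/-- `f` is antiholomorphic: `f_* ∘ J = - J' ∘ f_*`. -/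
def IsAntiholomorphicMap (K : IndefiniteKaehler E M) (K' : IndefiniteKaehler E M') (f : M → M') :
    Prop :=
  ∀ (p : M) (x : TangentSpace 𝓘(ℝ, E) p), push f p (K.J p x) = -K'.J (f p) (push f p x)

/-- `f^* g' = g`. -/
def PreservesMetric (K : IndefiniteKaehler E M) (K' : IndefiniteKaehler E M') (f : M → M') : Prop :=
  ∀ (p : M) (x y : TangentSpace 𝓘(ℝ, E) p), K'.g (f p) (push f p x) (push f p y) = K.g p x y

end Maps

end

open Set Filter Topology Bundle
open scoped Manifold ContDiff

/-! The argument is linear algebra in each tangent space, followed by one use of the Kähler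
condition.

Sign. At a point, `f_*⁻¹ J' f_*` squares to `-1` and maps each vector into its own complex line. In
complex dimension at least two this forces it to be `J` or `-J` (`eq_or_eq_neg_of_mem_span`). The
two alternatives are closed and disjoint, so on connected `M` one of them holds throughout.

Conformality. Let `h` be the pull-back of the second metric. If `h` vanishes on the null cone of
`g`, it is a multiple of `g` (`eq_smul_of_vanish_on_null`). Otherwise some null `ξ` has `h(ξ, ξ) ≠
0`. Near `ξ` the curvature `H'(f_* x)` stays bounded, so the limit condition bounds `H`, that is
`|R(x, Jx, Jx, x)| ≤ C g(x, x)²` near this one vector. Such a bound makes the quartic a constant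
multiple of `g²` (`quartic_eq_const_mul_sq`), hence `H` constant at the point. So `h` is
proportional to `g` wherever `H` is not constant. These points are dense and proportionality is a
closed condition, so it holds everywhere.

Constancy of the factor. `J` is parallel for `g` and also for `h = r g`, because `f` intertwines the
complex structures up to a constant sign. The difference of the two connections therefore commutes
with `J`, which gives `dr = 0` (`fderiv_eq_zero_of_conformal`).

Value of the factor. When `h = c g` with `c` constant, the curvature operators agree, so `H'(f_* x)
/ H(x)` is identically `1 / c`. At a null vector that is a limit of admissible vectors the
hypothesis then reads `c = 1`. -/

noncomputable section

/-! ### Functions which are polynomial on lines -/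

section PolynomialOnLines

variable {V : Type*} [NormedAddCommGroup V] [NormedSpace ℝ V]

/-- The restriction of `P` to every affine line is a polynomial function. -/
def PolynomialOnLines (P : V → ℝ) : Prop :=
  ∀ x v : V, ∃ p : Polynomial ℝ, ∀ t : ℝ, P (x + t • v) = p.eval t

namespace PolynomialOnLines

variable {P Q : V → ℝ}

theorem mul (hP : PolynomialOnLines P) (hQ : PolynomialOnLines Q) :
    PolynomialOnLines (fun x => P x * Q x) := fun x v => by
  obtain ⟨p, hp⟩ := hP x v
  obtain ⟨q, hq⟩ := hQ x v
  exact ⟨p * q, fun t => by simp [hp, hq]⟩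

theorem sub (hP : PolynomialOnLines P) (hQ : PolynomialOnLines Q) :
    PolynomialOnLines (fun x => P x - Q x) := fun x v => by
  obtain ⟨p, hp⟩ := hP x v
  obtain ⟨q, hq⟩ := hQ x v
  exact ⟨p - q, fun t => by simp [hp, hq]⟩

theorem const_mul (c : ℝ) (hP : PolynomialOnLines P) : PolynomialOnLines (fun x => c * P x) :=
  fun x v => by
    obtain ⟨p, hp⟩ := hP x v
    exact ⟨Polynomial.C c * p, fun t => by simp [hp]⟩

theorem of_clm (l : V →L[ℝ] ℝ) : PolynomialOnLines (fun x => l x) := fun x v =>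
  ⟨Polynomial.C (l x) + Polynomial.C (l v) * Polynomial.X, fun t => by
    simp only [map_add, map_smul, smul_eq_mul, Polynomial.eval_add, Polynomial.eval_mul,
      Polynomial.eval_C, Polynomial.eval_X]
    ring⟩

theorem of_bilin (g : V →L[ℝ] V →L[ℝ] ℝ) : PolynomialOnLines (fun x => g x x) := fun x v =>
  ⟨Polynomial.C (g x x) + Polynomial.X * Polynomial.C (g x v + g v x)
      + Polynomial.X ^ 2 * Polynomial.C (g v v), fun t => by simp; ring⟩

/-- The identity theorem. -/
theorem eq_zero (hP : PolynomialOnLines P) {x : V} (h : ∀ᶠ y in 𝓝 x, P y = 0) (y : V) :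
    P y = 0 := by
  obtain ⟨p, hp⟩ := hP x (y - x)
  have hc : Tendsto (fun t : ℝ => x + t • (y - x)) (𝓝 0) (𝓝 x) := by
    have : Continuous fun t : ℝ => x + t • (y - x) := by fun_prop
    simpa using this.tendsto 0
  have h0 : ∀ᶠ t in 𝓝 (0 : ℝ), p.eval t = 0 := by
    filter_upwards [hc.eventually h] with t ht
    rw [← hp, ht]
  have hp0 : p = 0 := by
    refine Polynomial.eq_zero_of_infinite_isRoot p ?_
    exact infinite_of_mem_nhds 0 h0
  have := hp 1
  simpa [hp0] using this

theorem dense (hP : PolynomialOnLines P) {v : V} (hv : P v ≠ 0) : Dense {x | P x ≠ 0} := by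
  intro x
  by_contra hx
  rw [mem_closure_iff_frequently] at hx
  simp only [mem_ofPred_eq, Filter.not_frequently, not_not] at hx
  exact hv (hP.eq_zero hx v)

end PolynomialOnLines

end PolynomialOnLines

/-! ### Quadratic and quartic forms -/

section Forms

variable {V : Type*} [NormedAddCommGroup V] [NormedSpace ℝ V]

/-- Linearity in each of four variables. -/
structure IsQuadrilinear (T : V → V → V → V → ℝ) : Prop where
  add₁ : ∀ x x' y z u, T (x + x') y z u = T x y z u + T x' y z u
  add₂ : ∀ x y y' z u, T x (y + y') z u = T x y z u + T x y' z u
  add₃ : ∀ x y z z' u, T x y (z + z') u = T x y z u + T x y z' u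
  add₄ : ∀ x y z u u', T x y z (u + u') = T x y z u + T x y z u'
  smul₁ : ∀ (t : ℝ) x y z u, T (t • x) y z u = t * T x y z u
  smul₂ : ∀ (t : ℝ) x y z u, T x (t • y) z u = t * T x y z u
  smul₃ : ∀ (t : ℝ) x y z u, T x y (t • z) u = t * T x y z u
  smul₄ : ∀ (t : ℝ) x y z u, T x y z (t • u) = t * T x y z u

namespace IsQuadrilinear

variable {T : V → V → V → V → ℝ}

/-- No symmetry of `T` is assumed, so each coefficient is a sum over the placements of `v`. The
coefficients are symmetric under exchanging `x` and `v` together with reversing the degree, which is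
exploited in `quartic_eq_const_mul_sq`. -/
theorem apply_add_smul (hT : IsQuadrilinear T) (x v : V) (t : ℝ) :
    T (x + t • v) (x + t • v) (x + t • v) (x + t • v) =
      T x x x x + (T v x x x + T x v x x + T x x v x + T x x x v) * t
      + (T x x v v + T x v x v + T x v v x + T v x x v + T v x v x + T v v x x) * t ^ 2
      + (T x v v v + T v x v v + T v v x v + T v v v x) * t ^ 3 + T v v v v * t ^ 4 := by
  simp only [hT.add₁, hT.add₂, hT.add₃, hT.add₄, hT.smul₁, hT.smul₂, hT.smul₃, hT.smul₄]
  ring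

theorem polynomialOnLines (hT : IsQuadrilinear T) : PolynomialOnLines (fun x => T x x x x) := by
  intro x v
  refine ⟨Polynomial.C (T x x x x)
      + Polynomial.C (T v x x x + T x v x x + T x x v x + T x x x v) * Polynomial.X
      + Polynomial.C (T x x v v + T x v x v + T x v v x + T v x x v + T v x v x + T v v x x)
        * Polynomial.X ^ 2
      + Polynomial.C (T x v v v + T v x v v + T v v x v + T v v v x) * Polynomial.X ^ 3
      + Polynomial.C (T v v v v) * Polynomial.X ^ 4, fun t => ?_⟩
  simp only [hT.apply_add_smul, Polynomial.eval_add, Polynomial.eval_mul, Polynomial.eval_C, Polynomial.eval_pow,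
    Polynomial.eval_X]

end IsQuadrilinear

/-- A quartic polynomial dominated near `0` by the square of `2αt + βt²`. -/
theorem quartic_coeff_of_le {a₀ a₁ a₂ a₃ a₄ C α β : ℝ}
    (h : ∀ᶠ t in 𝓝 (0 : ℝ), |a₀ + a₁ * t + a₂ * t ^ 2 + a₃ * t ^ 3 + a₄ * t ^ 4| ≤
      C * (2 * t * α + t ^ 2 * β) ^ 2) :
    a₀ = 0 ∧ a₁ = 0 ∧ |a₂| ≤ C * (2 * α) ^ 2 := by
  have h0 : a₀ = 0 := by simpa using h.self_of_nhds
  subst h0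
  have h' : ∀ᶠ t in 𝓝[≠] (0 : ℝ), |0 + a₁ * t + a₂ * t ^ 2 + a₃ * t ^ 3 + a₄ * t ^ 4| ≤
      C * (2 * t * α + t ^ 2 * β) ^ 2 := h.filter_mono nhdsWithin_le_nhds
  -- After division by `|t|` the right side still tends to `0`; dividing by `t ^ 2` later leaves the
  -- limit `C * (2 * α) ^ 2`.
  have h1 : |a₁| ≤ 0 := by
    have c1 : Tendsto (fun t : ℝ => |a₁ + a₂ * t + a₃ * t ^ 2 + a₄ * t ^ 3|) (𝓝[≠] 0)
        (𝓝 |a₁|) := by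
      have : Continuous fun t : ℝ => |a₁ + a₂ * t + a₃ * t ^ 2 + a₄ * t ^ 3| := by fun_prop
      simpa using (this.tendsto 0).mono_left nhdsWithin_le_nhds
    have c2 : Tendsto (fun t : ℝ => C * |t| * (2 * α + t * β) ^ 2) (𝓝[≠] 0) (𝓝 0) := by
      have : Continuous fun t : ℝ => C * |t| * (2 * α + t * β) ^ 2 := by fun_prop
      simpa using (this.tendsto 0).mono_left nhdsWithin_le_nhds
    refine le_of_tendsto_of_tendsto c1 c2 ?_
    filter_upwards [h', self_mem_nhdsWithin] with t ht ht0
    have ht0 : 0 < |t| := abs_pos.2 ht0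
    refine le_of_mul_le_mul_left ?_ ht0
    calc |t| * |a₁ + a₂ * t + a₃ * t ^ 2 + a₄ * t ^ 3|
        = |0 + a₁ * t + a₂ * t ^ 2 + a₃ * t ^ 3 + a₄ * t ^ 4| := by rw [← abs_mul]; congr 1; ring
      _ ≤ _ := ht
      _ = |t| * (C * |t| * (2 * α + t * β) ^ 2) := by
        linear_combination (-C * (2 * α + t * β) ^ 2) * abs_mul_abs_self t
  have h1 : a₁ = 0 := abs_nonpos_iff.1 h1
  subst h1
  refine ⟨rfl, rfl, ?_⟩
  have c1 : Tendsto (fun t : ℝ => |a₂ + a₃ * t + a₄ * t ^ 2|) (𝓝[≠] 0) (𝓝 |a₂|) := by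
    have : Continuous fun t : ℝ => |a₂ + a₃ * t + a₄ * t ^ 2| := by fun_prop
    simpa using (this.tendsto 0).mono_left nhdsWithin_le_nhds
  have c2 : Tendsto (fun t : ℝ => C * (2 * α + t * β) ^ 2) (𝓝[≠] 0) (𝓝 (C * (2 * α) ^ 2)) := by
    have : Continuous fun t : ℝ => C * (2 * α + t * β) ^ 2 := by fun_prop
    simpa using (this.tendsto 0).mono_left nhdsWithin_le_nhds
  refine le_of_tendsto_of_tendsto c1 c2 ?_
  filter_upwards [h', self_mem_nhdsWithin] with t ht ht0
  have ht0 : 0 < t ^ 2 := by have : t ≠ 0 := ht0; positivity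
  refine le_of_mul_le_mul_left ?_ ht0
  calc t ^ 2 * |a₂ + a₃ * t + a₄ * t ^ 2|
      = |0 + 0 * t + a₂ * t ^ 2 + a₃ * t ^ 3 + a₄ * t ^ 4| := by
        rw [← abs_of_pos ht0, ← abs_mul, abs_of_pos ht0]; congr 1; ring
    _ ≤ _ := ht
    _ = _ := by ring

theorem eq_zero_of_affine_bounded {a b K : ℝ} (h : ∀ s : ℝ, |a + s * b| ≤ K) : b = 0 := by
  by_contra hb
  have h1 := (abs_le.1 (h ((K + 1 - a) / b))).2
  rw [div_mul_cancel₀ _ hb] at h1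
  linarith

/-- A quadratic form dominated by the square of a linear form is a multiple of it. -/
theorem quadratic_eq_of_le_sq {b : V → V → ℝ} (l : V →L[ℝ] ℝ) {K : ℝ} (hl : l ≠ 0)
    (add₁ : ∀ x y z, b (x + y) z = b x z + b y z) (add₂ : ∀ x y z, b x (y + z) = b x y + b x z)
    (smul₁ : ∀ (t : ℝ) x y, b (t • x) y = t * b x y)
    (smul₂ : ∀ (t : ℝ) x y, b x (t • y) = t * b x y)
    (h : ∀ v, |b v v| ≤ K * l v ^ 2) : ∃ c, ∀ v, b v v = c * l v ^ 2 := by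
  obtain ⟨e, he⟩ : ∃ e, l e ≠ 0 := by
    by_contra hcon
    push Not at hcon
    exact hl (by ext x; simpa using hcon x)
  refine ⟨b e e / l e ^ 2, fun v => ?_⟩
  obtain ⟨u, hu, hv⟩ : ∃ u, l u = 0 ∧ v = (l v / l e) • e + u :=
    ⟨v - (l v / l e) • e, by simp [he], by abel⟩
  have huu : b u u = 0 := by simpa [hu] using h u
  -- With `b u u = 0` the value on `e + s • u` is affine in `s`, while the bound does not depend on
  -- `s` because `l u = 0`. Hence the cross term vanishes.
  have hub : b e u + b u e = 0 := by
    refine eq_zero_of_affine_bounded (a := b e e) (K := K * l e ^ 2) fun s => ?_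
    have := h (e + s • u)
    simp only [add₁, add₂, smul₁, smul₂, map_add, map_smul, hu, huu, smul_eq_mul] at this
    convert this using 2 <;> ring
  have hb : b v v = (l v / l e) ^ 2 * b e e := by
    rw [hv]
    simp only [add₁, add₂, smul₁, smul₂, map_add, map_smul, hu, huu, smul_eq_mul, add_zero]
    rw [mul_div_assoc, div_self he, mul_one]
    linear_combination (l v / l e) * hub
  rw [hb]
  ring

/-! ### Null vectors, and forms controlled on the null cone. -/

theorem exists_ne_zero_orthogonal [FiniteDimensional ℝ V] (hdim : 3 ≤ Module.finrank ℝ V)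
    (k l : V →L[ℝ] ℝ) : ∃ x ≠ 0, k x = 0 ∧ l x = 0 := by
  have hlt : Module.finrank ℝ (ℝ × ℝ) < Module.finrank ℝ V := by
    simp only [Module.finrank_prod, Module.finrank_self]; omega
  obtain ⟨x, hx, hx0⟩ := (Submodule.ne_bot_iff _).1
    (LinearMap.ker_ne_bot_of_finrank_lt (f := (k.prod l).toLinearMap) hlt)
  have : (k x, l x) = (0 : ℝ × ℝ) := hx
  exact ⟨x, hx0, congrArg Prod.fst this, congrArg Prod.snd this⟩

/-- The projection onto the null cone of `g` along the direction of a null vector `v`. -/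
def nullProj (g : V →L[ℝ] V →L[ℝ] ℝ) (v x : V) : V := x - (g x x / (2 * g x v)) • v

theorem nullProj_isNull {g : V →L[ℝ] V →L[ℝ] ℝ} (symm : ∀ x y, g x y = g y x) {v x : V}
    (hv : g v v = 0) (hx : g x v ≠ 0) : g (nullProj g v x) (nullProj g v x) = 0 := by
  simp only [nullProj, map_sub, map_smul, sub_apply,
    smul_apply, smul_eq_mul, hv, symm v x]
  field_simp
  ring

theorem continuousAt_nullProj (g : V →L[ℝ] V →L[ℝ] ℝ) {v ξ : V} (hξ : g ξ ξ = 0)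
    (h : g ξ v ≠ 0) : Tendsto (nullProj g v) (𝓝 ξ) (𝓝 ξ) := by
  have : ContinuousAt (nullProj g v) ξ := by
    unfold nullProj
    have h2 : 2 * g ξ v ≠ 0 := by positivity
    fun_prop (disch := assumption)
  simpa [ContinuousAt, nullProj, hξ] using this

theorem exists_null_not_orthogonal {g : V →L[ℝ] V →L[ℝ] ℝ} (symm : ∀ x y, g x y = g y x)
    (nondeg : ∀ x, (∀ y, g x y = 0) → x = 0) {ξ : V} (hξ0 : ξ ≠ 0) (hξ : g ξ ξ = 0) :
    ∃ v, g v v = 0 ∧ g ξ v ≠ 0 := by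
  obtain ⟨y, hy⟩ : ∃ y, g ξ y ≠ 0 := by
    by_contra h
    push Not at h
    exact hξ0 (nondeg ξ h)
  refine ⟨nullProj g ξ y, nullProj_isNull symm hξ (by rwa [symm]), ?_⟩
  simpa [nullProj, hξ] using hy

/-- There are null vectors arbitrarily close to `ξ` which are not orthogonal to `ξ`. -/
theorem exists_null_near [FiniteDimensional ℝ V] (hdim : 3 ≤ Module.finrank ℝ V)
    {g : V →L[ℝ] V →L[ℝ] ℝ} (symm : ∀ x y, g x y = g y x)
    (nondeg : ∀ x, (∀ y, g x y = 0) → x = 0) {ξ : V} (hξ0 : ξ ≠ 0) (hξ : g ξ ξ = 0)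
    {N : V → Prop} (hN : ∀ᶠ x in 𝓝 ξ, N x) : ∃ η, g η η = 0 ∧ g ξ η ≠ 0 ∧ N η := by
  obtain ⟨v, hv, hξv⟩ := exists_null_not_orthogonal symm nondeg hξ0 hξ
  -- Up to the factor `2 * g x v`, this quadratic polynomial is the product of `ξ` with the null
  -- projection of `x` along `v`; it must be nonzero at points close to `ξ`.
  have hP : PolynomialOnLines fun x => 2 * (g.flip v x * g ξ x) - g ξ v * g x x :=
    (((PolynomialOnLines.of_clm (g.flip v)).mul (.of_clm (g ξ))).const_mul 2).sub
      ((PolynomialOnLines.of_bilin g).const_mul _)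
  -- Were it identically zero, `g x x` would be proportional to a product of two linear forms. A
  -- common zero of these, which exists in dimension at least three, would be a nonzero vector in
  -- the kernel of `g`.
  obtain ⟨w, hw⟩ : ∃ w, 2 * (g.flip v w * g ξ w) - g ξ v * g w w ≠ 0 := by
    by_contra hcon
    push Not at hcon
    obtain ⟨x, hx0, h1, h2⟩ := exists_ne_zero_orthogonal hdim (g.flip v) (g ξ)
    refine hx0 (nondeg x fun y => ?_)
    have e1 := hcon (x + y)
    have e2 := hcon x
    have e3 := hcon y
    simp only [map_add, add_apply, h1, h2, symm y x] at e1 e2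
    have : g ξ v * g x y = 0 := by linear_combination (-e1 + e2 + e3) / 2
    exact (mul_eq_zero.1 this).resolve_left hξv
  have hne : ∀ᶠ x in 𝓝 ξ, g x v ≠ 0 :=
    (show ContinuousAt (fun x => g x v) ξ by fun_prop).eventually_ne hξv
  obtain ⟨x, hx, hxv, hNx⟩ := ((mem_closure_iff_frequently.1 (hP.dense hw ξ)).and_eventually
    (hne.and ((continuousAt_nullProj g hξ hξv).eventually hN))).exists
  refine ⟨_, nullProj_isNull symm hv hxv, fun h0 => hx ?_, hNx⟩
  simp only [nullProj, map_sub, map_smul, smul_eq_mul] at h0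
  field_simp at h0
  simp only [ContinuousLinearMap.flip_apply]
  linear_combination h0

/-- A quartic form which is dominated by the square of the metric near a single null vector is a
multiple of the square of the metric. -/
theorem quartic_eq_const_mul_sq [FiniteDimensional ℝ V] (hdim : 3 ≤ Module.finrank ℝ V)
    {g : V →L[ℝ] V →L[ℝ] ℝ} (symm : ∀ x y, g x y = g y x)
    (nondeg : ∀ x, (∀ y, g x y = 0) → x = 0) {T : V → V → V → V → ℝ} (hT : IsQuadrilinear T)
    {ξ : V} (hξ0 : ξ ≠ 0) (hξ : g ξ ξ = 0) {C : ℝ}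
    (hC : ∀ᶠ x in 𝓝 ξ, |T x x x x| ≤ C * g x x ^ 2) : ∃ c, ∀ x, T x x x x = c * g x x ^ 2 := by
  -- Along a line through a null `η`, `g` takes the value `2 t g(η, v) + t² g(v, v)`, so the bound
  -- kills the coefficients of degree 0 and 1 and controls the one of degree 2.
  have key : ∀ η, g η η = 0 → (∀ᶠ x in 𝓝 η, |T x x x x| ≤ C * g x x ^ 2) → ∀ v,
      T η η η η = 0 ∧ (T v η η η + T η v η η + T η η v η + T η η η v) = 0 ∧
      |T η η v v + T η v η v + T η v v η + T v η η v + T v η v η + T v v η η|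
        ≤ C * (2 * g η v) ^ 2 := by
    intro η hη hCη v
    have hc : Tendsto (fun t : ℝ => η + t • v) (𝓝 0) (𝓝 η) := by
      have : Continuous fun t : ℝ => η + t • v := by fun_prop
      simpa using this.tendsto 0
    refine quartic_coeff_of_le (β := g v v) ?_ (a₃ := T η v v v + T v η v v + T v v η v + T v v v η)
      (a₄ := T v v v v)
    filter_upwards [hc.eventually hCη] with t ht
    rw [hT.apply_add_smul] at ht
    convert ht using 3
    simp only [map_add, map_smul, add_apply, smul_apply,
      smul_eq_mul, hη, symm v η]
    ring
  obtain ⟨η, hη, hξη, hCη⟩ := exists_null_near hdim symm nondeg hξ0 hξ hC.eventually_nhds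
  -- The degree 2 coefficient at `η`, as a quadratic form in the direction `v`, is dominated by
  -- `g(η, v)²` and hence is a multiple of it.
  obtain ⟨c, hc⟩ := quadratic_eq_of_le_sq (K := C * 4)
    (b := fun v w => T η η v w + T η v η w + T η v w η + T v η η w + T v η w η + T v w η η)
    (g η) (fun h => hξη (by rw [symm, h]; simp))
    (fun x y z => by simp only [hT.add₁, hT.add₂, hT.add₃]; ring)
    (fun x y z => by simp only [hT.add₂, hT.add₃, hT.add₄]; ring)
    (fun t x y => by simp only [hT.smul₁, hT.smul₂, hT.smul₃]; ring)
    (fun t x y => by simp only [hT.smul₂, hT.smul₃, hT.smul₄]; ring)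
    (fun v => (key η hη hCη v).2.2.trans_eq (by ring))
  refine ⟨c / 4, fun y => sub_eq_zero.1 ?_⟩
  have hpoly : PolynomialOnLines fun x => T x x x x - c / 4 * (g x x * g x x) :=
    hT.polynomialOnLines.sub
      (((PolynomialOnLines.of_bilin g).mul (PolynomialOnLines.of_bilin g)).const_mul _)
  rw [pow_two]
  refine hpoly.eq_zero (x := ξ) ?_ y
  have hne : ∀ᶠ x in 𝓝 ξ, g x η ≠ 0 :=
    (show ContinuousAt (fun x => g x η) ξ by fun_prop).eventually_ne hξη
  -- Write `x = ζ + s η` with `ζ` null and close to `ξ`, and `s = g(x, x) / (2 g(x, η))`. In the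
  -- expansion in `s`, degrees 0 and 1 vanish by the bound at `ζ`, and degrees 4 and 3 by the bound
  -- at `η`. What remains is `s² c g(η, ζ)²`, which equals `c/4 · g(x, x)²`.
  filter_upwards [hne, (continuousAt_nullProj g hξ hξη).eventually hC.eventually_nhds] with x hx hCx
  have k1 := key _ (nullProj_isNull symm hη hx) hCx η
  have k2 := key η hη hCη (nullProj g η x)
  have hcx := hc (nullProj g η x)
  have hxe : x = nullProj g η x + (g x x / (2 * g x η)) • η := by simp [nullProj]
  have hg : g η (nullProj g η x) = g x η := by simp [nullProj, hη, symm x η]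
  have e := hT.apply_add_smul (nullProj g η x) η (g x x / (2 * g x η))
  rw [← hxe, k1.1, k1.2.1, k2.1] at e
  rw [hg] at hcx
  have k3 : T (nullProj g η x) η η η + T η (nullProj g η x) η η + T η η (nullProj g η x) η
      + T η η η (nullProj g η x) = 0 := k2.2.1
  rw [k3] at e
  have hh : (g x x / (2 * g x η)) ^ 2 * (g x η) ^ 2 = g x x * g x x / 4 := by field_simp; ring
  linear_combination e + (g x x / (2 * g x η)) ^ 2 * hcx + c * hh

/-- A symmetric form which vanishes on the null cone of an indefinite form `g` is a multiple of
`g`. -/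
theorem eq_smul_of_vanish_on_null {g h : V →L[ℝ] V →L[ℝ] ℝ} (gsymm : ∀ x y, g x y = g y x)
    (hsymm : ∀ x y, h x y = h y x) (indef : (∃ x, 0 < g x x) ∧ ∃ x, g x x < 0)
    (hnull : ∀ x, x ≠ 0 → g x x = 0 → h x x = 0) : ∃ c, ∀ x y, h x y = c * g x y := by
  -- The line through `x` in direction `y` meets the null cone at the two real roots `t = (-g(x, y)
  -- ± d) / g(y, y)`. Both annihilate `h` as well, so the two quadratic polynomials in `t` are
  -- proportional.
  have opp : ∀ x y, 0 < g x x → g y y < 0 → h x x * g y y = h y y * g x x := by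
    intro x y hx hy
    have hne : ∀ t : ℝ, x + t • y ≠ 0 := by
      intro t ht
      have : x = -(t • y) := eq_neg_of_add_eq_zero_left ht
      rw [this] at hx
      simp only [map_neg, map_smul, neg_apply, smul_apply,
        smul_eq_mul] at hx
      nlinarith [sq_nonneg t]
    have hy0 : g y y ≠ 0 := hy.ne
    set d := Real.sqrt (g x y ^ 2 - g x x * g y y) with hd
    have hdpos : 0 < d := Real.sqrt_pos.2 (by nlinarith [sq_nonneg (g x y)])
    have hdd : d ^ 2 = g x y ^ 2 - g x x * g y y :=
      Real.sq_sqrt (by nlinarith [sq_nonneg (g x y)])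
    have hroot : ∀ e : ℝ, e ^ 2 = d ^ 2 →
        h x x * g y y ^ 2 + 2 * (-g x y + e) * h x y * g y y + (-g x y + e) ^ 2 * h y y = 0 := by
      intro e he
      have h1 := hnull (x + ((-g x y + e) / g y y) • y) (hne _) (by
        simp only [map_add, map_smul, add_apply,
          smul_apply, smul_eq_mul, gsymm y x]
        field_simp
        linear_combination he + hdd)
      simp only [map_add, map_smul, add_apply,
        smul_apply, smul_eq_mul, hsymm y x] at h1
      field_simp at h1
      linear_combination h1
    have r1 := hroot d rfl
    have r2 := hroot (-d) (by ring)
    have e1 : h x y * g y y = g x y * h y y := by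
      have : d * (h x y * g y y - g x y * h y y) = 0 := by linear_combination (r1 - r2) / 4
      linarith [(mul_eq_zero.1 this).resolve_left hdpos.ne']
    have : g y y * (h x x * g y y - h y y * g x x) = 0 := by
      linear_combination (r1 + r2) / 2 + 2 * g x y * e1 - h y y * hdd
    linarith [(mul_eq_zero.1 this).resolve_left hy.ne]
  obtain ⟨⟨a, ha⟩, b, hb⟩ := indef
  have hab := opp a b ha hb
  have diag : ∀ x, h x x = h a a / g a a * g x x := by
    intro x
    rcases lt_trichotomy (g x x) 0 with hx | hx | hx
    · have := opp a x ha hx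
      field_simp
      linarith
    · by_cases hx0 : x = 0
      · simp [hx0]
      · rw [hx, hnull x hx0 hx, mul_zero]
    · have := opp x b hx hb
      field_simp
      have h2 : g b b * (h x x * g a a - g x x * h a a) = 0 := by
        linear_combination g a a * this - g x x * hab
      linarith [(mul_eq_zero.1 h2).resolve_left hb.ne]
  refine ⟨h a a / g a a, fun x y => ?_⟩
  have e1 := diag (x + y)
  simp only [map_add, add_apply, gsymm y x, hsymm y x] at e1
  linear_combination (e1 - diag x - diag y) / 2

theorem exists_null {g : V →L[ℝ] V →L[ℝ] ℝ} (gsymm : ∀ x y, g x y = g y x)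
    (indef : (∃ x, 0 < g x x) ∧ ∃ x, g x x < 0) : ∃ x ≠ 0, g x x = 0 := by
  by_contra hcon
  push Not at hcon
  obtain ⟨⟨a, ha⟩, b, hb⟩ := indef
  -- Without null vectors every symmetric form would be a multiple of `g`. The semidefinite form
  -- `g(a, ·)²` is not: it forces `c = g(a, a) > 0` and then has the wrong sign at `b`.
  obtain ⟨c, hc⟩ := eq_smul_of_vanish_on_null (g := g)
    (h := (ContinuousLinearMap.mul ℝ ℝ).bilinearComp (g a) (g a)) gsymm
    (fun x y => by simp [mul_comm]) ⟨⟨a, ha⟩, b, hb⟩ (fun x h0 h1 => absurd h1 (hcon x h0))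
  have h1 : g a b * g a b = c * g b b := by simpa using hc b b
  have h2 : g a a * g a a = c * g a a := by simpa using hc a a
  have hc0 : g a a = c := mul_right_cancel₀ ha.ne' h2
  nlinarith [mul_self_nonneg (g a b)]

/-- If the quotient `(k / h²) / (q / g²)` tends to `1` at all null vectors of `g`, then the quartic
form `q` is a multiple of `g²`, or `h` is a multiple of `g`. -/
theorem eq_const_or_conformal_of_ratio [FiniteDimensional ℝ V] (hdim : 3 ≤ Module.finrank ℝ V)
    {g h : V →L[ℝ] V →L[ℝ] ℝ} (gsymm : ∀ x y, g x y = g y x) (hsymm : ∀ x y, h x y = h y x)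
    (nondeg : ∀ x, (∀ y, g x y = 0) → x = 0) (indef : (∃ x, 0 < g x x) ∧ ∃ x, g x x < 0)
    {T : V → V → V → V → ℝ} (hT : IsQuadrilinear T) (hTc : Continuous fun x => T x x x x)
    {k : V → ℝ} (hk : Continuous k)
    (hlim : ∀ ξ, ξ ≠ 0 → g ξ ξ = 0 →
      Tendsto (fun x => (k x / h x x ^ 2) / (T x x x x / g x x ^ 2))
        (𝓝[{x | g x x ≠ 0 ∧ h x x ≠ 0 ∧ T x x x x / g x x ^ 2 ≠ 0}] ξ) (𝓝 1)) :
    (∃ c, ∀ x, T x x x x = c * g x x ^ 2) ∨ ∃ c, ∀ x y, h x y = c * g x y := by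
  by_cases hnull : ∀ x, x ≠ 0 → g x x = 0 → h x x = 0
  · exact Or.inr (eq_smul_of_vanish_on_null gsymm hsymm indef hnull)
  left
  push Not at hnull
  obtain ⟨ξ, hξ0, hξ, hhξ⟩ := hnull
  have hcont : ContinuousAt (fun x => |k x / h x x ^ 2|) ξ := by
    have : h ξ ξ ^ 2 ≠ 0 := pow_ne_zero 2 hhξ
    fun_prop (disch := assumption)
  set C₀ := |k ξ / h ξ ξ ^ 2| + 1
  have h1 : ∀ᶠ x in 𝓝 ξ, |k x / h x x ^ 2| < C₀ := hcont.eventually_lt_const (by simp [C₀])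
  have h2 : ∀ᶠ x in 𝓝 ξ, h x x ≠ 0 :=
    (show ContinuousAt (fun x => h x x) ξ by fun_prop).eventually_ne hhξ
  -- A quotient above `1 / 2` with numerator below `C₀` bounds the denominator by `2 * C₀`. Vectors
  -- with zero quartic are outside the quotient's domain, but satisfy the bound trivially.
  have h3 := eventually_nhdsWithin_iff.1
    ((hlim ξ hξ0 hξ).eventually_const_lt (show (1 / 2 : ℝ) < 1 by norm_num))
  have hev : ∀ᶠ x in 𝓝 ξ, g x x ≠ 0 → |T x x x x| ≤ (2 * C₀) * g x x ^ 2 := by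
    filter_upwards [h1, h2, h3] with x h1 h2 h3 hgx
    by_cases hTx : T x x x x = 0
    · rw [hTx, abs_zero]
      have : 0 ≤ C₀ := (abs_nonneg _).trans h1.le
      positivity
    have hq : T x x x x / g x x ^ 2 ≠ 0 := div_ne_zero hTx (pow_ne_zero 2 hgx)
    have h4 := (h3 ⟨hgx, h2, hq⟩).trans_le (le_abs_self _)
    rw [abs_div, lt_div_iff₀ (abs_pos.2 hq), abs_div, abs_of_pos (show 0 < g x x ^ 2 by positivity)]
      at h4
    rw [← div_le_iff₀ (by positivity)]
    linarith
  refine quartic_eq_const_mul_sq hdim gsymm nondeg hT hξ0 hξ (C := 2 * C₀) ?_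
  -- The bound is known only off the null cone; it extends to the cone because the complement is
  -- dense and the inequality is closed.
  obtain ⟨a, ha⟩ := indef.1
  have hdense := (PolynomialOnLines.of_bilin g).dense ha.ne'
  have hclosed : IsClosed {x | |T x x x x| ≤ (2 * C₀) * g x x ^ 2} :=
    isClosed_le hTc.abs (by fun_prop)
  filter_upwards [hev.eventually_nhds] with x hx
  refine hclosed.closure_subset (mem_closure_iff_frequently.2 ?_)
  exact ((mem_closure_iff_frequently.1 (hdense x)).and_eventually hx).mono fun y hy => hy.2 hy.1

/-! ### Linear algebra of a complex structure. -/

/-- Applying the conjugate `γ - δJ` turns the given element into `(γ² + δ²) • y`, still in the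
complex subspace `L`. This is complex linear independence modulo `L`. -/
theorem coeff_eq_zero_of_mem {J : V →L[ℝ] V} (hJ : ∀ x, J (J x) = -x) {L : Submodule ℝ V}
    (hL : ∀ x ∈ L, J x ∈ L) {y : V} (hy : y ∉ L) {γ δ : ℝ} (h : γ • y + δ • J y ∈ L) :
    γ = 0 ∧ δ = 0 := by
  by_contra hcon
  have hpos : γ ^ 2 + δ ^ 2 ≠ 0 := by
    intro h0
    exact hcon ⟨by nlinarith [sq_nonneg γ, sq_nonneg δ], by nlinarith [sq_nonneg γ, sq_nonneg δ]⟩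
  have h1 : (γ ^ 2 + δ ^ 2) • y ∈ L := by
    have := L.sub_mem (L.smul_mem γ h) (L.smul_mem δ (hL _ h))
    convert this using 1
    simp only [map_add, map_smul, hJ]
    module
  exact hy ((L.smul_mem_iff hpos).1 h1)

theorem mem_span_pair_J {J : V →L[ℝ] V} (hJ : ∀ x, J (J x) = -x) (x : V) :
    ∀ y ∈ Submodule.span ℝ {x, J x}, J y ∈ Submodule.span ℝ {x, J x} := by
  intro y hy
  obtain ⟨a, b, rfl⟩ := Submodule.mem_span_pair.1 hy
  exact Submodule.mem_span_pair.2 ⟨-b, a, by simp only [map_add, map_smul, hJ]; module⟩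

/-- If a real linear endomorphism `A` with `A² = -1` maps each vector `x` into the complex line
spanned by `x`, then `A` is plus or minus the multiplication by `i`. -/
theorem eq_or_eq_neg_of_mem_span [FiniteDimensional ℝ V] (hdim : 3 ≤ Module.finrank ℝ V)
    {J A : V →L[ℝ] V} (hJ : ∀ x, J (J x) = -x) (hA : ∀ x, A (A x) = -x)
    (h : ∀ x, x ≠ 0 → A x ∈ Submodule.span ℝ {x, J x}) :
    (∀ x, A x = J x) ∨ ∀ x, A x = -J x := by
  -- Comparing `A (x + y)` with `A x + A y` modulo the complex line of `x` shows that independent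
  -- vectors share the same complex eigenvalue `a + bi`.
  have indep : ∀ (x y : V) (a b : ℝ), x ≠ 0 → y ∉ Submodule.span ℝ {x, J x} →
      A x = a • x + b • J x → A y = a • y + b • J y := by
    intro x y a b hx hy hax
    have hx0 : x ∉ (⊥ : Submodule ℝ V) := by simpa using hx
    have hbot : ∀ z ∈ (⊥ : Submodule ℝ V), J z ∈ (⊥ : Submodule ℝ V) := by
      intro z hz
      simp [(Submodule.mem_bot ℝ).1 hz]
    have hy0 : y ≠ 0 := fun h0 => hy (h0 ▸ Submodule.zero_mem _)
    have hxy0 : x + y ≠ 0 := fun h0 =>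
      hy (by
        rw [eq_neg_of_add_eq_zero_right h0]
        exact Submodule.neg_mem _ (Submodule.subset_span (by simp)))
    obtain ⟨a', b', h1⟩ := Submodule.mem_span_pair.1 (h y hy0)
    obtain ⟨c, d, h2⟩ := Submodule.mem_span_pair.1 (h _ hxy0)
    have e : (c - a') • y + (d - b') • J y = (a - c) • x + (b - d) • J x := by
      rw [map_add A, hax, ← h1, map_add J] at h2
      linear_combination (norm := module) (1 : ℝ) • h2
    obtain ⟨e1, e2⟩ := coeff_eq_zero_of_mem hJ (mem_span_pair_J hJ x) hy
      (e.symm ▸ Submodule.mem_span_pair.2 ⟨a - c, b - d, rfl⟩)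
    obtain ⟨e3, e4⟩ := coeff_eq_zero_of_mem (γ := a - c) (δ := b - d) hJ hbot hx0
      (by rw [← e, e1, e2]; simp)
    rw [← h1, show a = a' by linarith, show b = b' by linarith]
  have : Nontrivial V := Module.nontrivial_of_finrank_pos (R := ℝ) (by omega)
  obtain ⟨x, hx⟩ := exists_ne (0 : V)
  have hlt : Submodule.span ℝ {x, J x} ≠ ⊤ := by
    intro htop
    classical
    have h1 := finrank_span_finset_le_card (R := ℝ) ({x, J x} : Finset V)
    rw [Finset.coe_pair, Set.finrank, htop, finrank_top] at h1
    have h2 := Finset.card_le_two (a := x) (b := J x)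
    omega
  obtain ⟨z, -, hz⟩ := SetLike.exists_of_lt (lt_top_iff_ne_top.2 hlt)
  obtain ⟨a, b, hab⟩ := Submodule.mem_span_pair.1 (h x hx)
  have hz0 : z ≠ 0 := fun h0 => hz (h0 ▸ Submodule.zero_mem _)
  have hAz := indep x z a b hx hz hab.symm
  have hall : ∀ y, A y = a • y + b • J y := by
    intro y
    by_cases hy : y ∈ Submodule.span ℝ {x, J x}
    · by_cases hy0 : y = 0
      · simp [hy0]
      -- Vectors inside the line of `x` are reached through the auxiliary vector `z` outside it.
      refine indep z y a b hz0 (fun hyz => ?_) hAz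
      obtain ⟨r, s, hrs⟩ := Submodule.mem_span_pair.1 hyz
      obtain ⟨r0, s0⟩ := coeff_eq_zero_of_mem hJ (mem_span_pair_J hJ x) hz (hrs ▸ hy)
      exact hy0 (by rw [← hrs, r0, s0]; simp)
    · exact indep x y a b hx hy hab.symm
  have hsq : (a ^ 2 - b ^ 2 + 1) • x + (2 * a * b) • J x = 0 := by
    have h1 := hA x
    simp only [hall, map_add, map_smul, hJ] at h1
    linear_combination (norm := module) (1 : ℝ) • h1
  obtain ⟨e1, e2⟩ := coeff_eq_zero_of_mem (L := ⊥) (y := x) (γ := a ^ 2 - b ^ 2 + 1)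
    (δ := 2 * a * b) hJ (fun z hz => by simp [(Submodule.mem_bot ℝ).1 hz]) (by simpa using hx)
    (by rw [hsq]; simp)
  have ha : a = 0 := by
    rcases mul_eq_zero.1 e2 with h0 | h0
    · linarith
    · rw [h0] at e1; nlinarith [sq_nonneg a]
  subst ha
  have hb : (b - 1) * (b + 1) = 0 := by linarith
  rcases mul_eq_zero.1 hb with h0 | h0
  · exact Or.inl fun y => by rw [hall, show b = 1 by linarith]; simp
  · exact Or.inr fun y => by rw [hall, show b = -1 by linarith]; simp

end Forms

set_option maxSynthPendingDepth 3
set_option synthInstance.maxHeartbeats 100000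
set_option linter.unusedSectionVars false

theorem minSmoothness_two_le_infty : minSmoothness ℝ 2 ≤ ∞ := by
  simp only [minSmoothness_of_isRCLikeNormedField]
  exact WithTop.coe_le_coe.2 le_top

/-! ### Naturality of the Levi-Civita connection -/

namespace LocalGeometry

variable {E : Type*} [NormedAddCommGroup E] [NormedSpace ℝ E]

/-- `G` is smooth at `y`, symmetric and nondegenerate there. -/
structure IsSmoothMetricAt (G : E → E →L[ℝ] E →L[ℝ] ℝ) (y : E) : Prop where
  contDiffAt : ContDiffAt ℝ ∞ G y
  symm : ∀ u v, G y u v = G y v u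
  nondeg : ∀ u, (∀ v, G y u v = 0) → u = 0

/-- The Christoffel symbol of the first kind as a bilinear map. -/
def christoffelLowerCLM (G : E → E →L[ℝ] E →L[ℝ] ℝ) (y : E) : E →L[ℝ] E →L[ℝ] E →L[ℝ] ℝ :=
  (1 / 2 : ℝ) • (fderiv ℝ G y + (fderiv ℝ G y).flip -
    ((ContinuousLinearMap.flipₗᵢ ℝ E E ℝ).toContinuousLinearEquiv :
      (E →L[ℝ] E →L[ℝ] ℝ) →L[ℝ] E →L[ℝ] E →L[ℝ] ℝ) ∘L (fderiv ℝ G y).flip)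

/-- The Christoffel symbol of the second kind as a bilinear map. -/
def christoffelCLM (G : E → E →L[ℝ] E →L[ℝ] ℝ) (y : E) : E →L[ℝ] E →L[ℝ] E :=
  ContinuousLinearMap.compL ℝ E (E →L[ℝ] ℝ) E (G y).inverse ∘L christoffelLowerCLM G y

theorem christoffelLowerCLM_apply (G : E → E →L[ℝ] E →L[ℝ] ℝ) (y u v : E) :
    christoffelLowerCLM G y u v = christoffelLower G y u v := by
  ext w
  simp [christoffelLowerCLM, christoffelLower]

theorem christoffelCLM_apply (G : E → E →L[ℝ] E →L[ℝ] ℝ) (y u v : E) :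
    christoffelCLM G y u v = christoffel G y u v := by
  simp [christoffelCLM, christoffel, christoffelLowerCLM_apply]

section

variable {G G' : E → E →L[ℝ] E →L[ℝ] ℝ} {F : E → E} {y : E}

/-- `G` is the pull-back of `G'` by `F` near `y`. -/
def IsPullbackNear (G G' : E → E →L[ℝ] E →L[ℝ] ℝ) (F : E → E) (y : E) : Prop :=
  ∀ᶠ z in 𝓝 y, ∀ u v, G z u v = G' (F z) (fderiv ℝ F z u) (fderiv ℝ F z v)

theorem fderiv_pullback (hG : DifferentiableAt ℝ G y) (hG' : DifferentiableAt ℝ G' (F y))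
    (hF : ContDiffAt ℝ ∞ F y) (hp : IsPullbackNear G G' F y) (a u v : E) :
    fderiv ℝ G y a u v =
      fderiv ℝ G' (F y) (fderiv ℝ F y a) (fderiv ℝ F y u) (fderiv ℝ F y v)
      + G' (F y) (fderiv ℝ (fderiv ℝ F) y a u) (fderiv ℝ F y v)
      + G' (F y) (fderiv ℝ F y u) (fderiv ℝ (fderiv ℝ F) y a v) := by
  have hF1 : HasFDerivAt F (fderiv ℝ F y) y := (hF.differentiableAt (by simp)).hasFDerivAt
  have hF2 : HasFDerivAt (fderiv ℝ F) (fderiv ℝ (fderiv ℝ F) y) y :=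
    ((hF.fderiv_right (m := ∞) (by simp)).differentiableAt (by simp)).hasFDerivAt
  have e1 := (hG.hasFDerivAt.clm_apply (hasFDerivAt_const u y)).clm_apply (hasFDerivAt_const v y)
  have e2 := ((hG'.hasFDerivAt.comp y hF1).clm_apply
    (hF2.clm_apply (hasFDerivAt_const u y))).clm_apply (hF2.clm_apply (hasFDerivAt_const v y))
  have e3 := e2.congr_of_eventuallyEq (hp.mono fun z hz => hz u v)
  have e4 := congrArg (fun L : E →L[ℝ] ℝ => L a) (e1.unique e3)
  simp at e4
  linarith

/-- Of the six second-derivative terms produced by the product rule, symmetry of the second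
derivative of `F` and of `G'` cancels four and merges the other two. -/
theorem christoffelLower_pullback (hG : DifferentiableAt ℝ G y) (hG' : IsSmoothMetricAt G' (F y))
    (hF : ContDiffAt ℝ ∞ F y) (hp : IsPullbackNear G G' F y) (u v w : E) :
    christoffelLower G y u v w =
      christoffelLower G' (F y) (fderiv ℝ F y u) (fderiv ℝ F y v) (fderiv ℝ F y w)
      + G' (F y) (fderiv ℝ (fderiv ℝ F) y u v) (fderiv ℝ F y w) := by
  have hs : ∀ a b, fderiv ℝ (fderiv ℝ F) y a b = fderiv ℝ (fderiv ℝ F) y b a :=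
    hF.isSymmSndFDerivAt minSmoothness_two_le_infty
  simp only [christoffelLower_apply,
    fderiv_pullback hG (hG'.contDiffAt.differentiableAt (by simp)) hF hp]
  rw [hs w u, hs w v, hs v u, hG'.symm (fderiv ℝ F y v), hG'.symm (fderiv ℝ F y u)]
  ring

end

section

variable {G : E → E →L[ℝ] E →L[ℝ] ℝ} {y : E} {r : E → ℝ}

theorem IsSmoothMetricAt.smul (hG : IsSmoothMetricAt G y) (hr : ContDiffAt ℝ ∞ r y)
    (hr0 : r y ≠ 0) : IsSmoothMetricAt (fun z => r z • G z) y where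
  contDiffAt := hr.smul hG.contDiffAt
  symm u v := by simp [hG.symm u v]
  nondeg u h := hG.nondeg u fun v => by simpa [hr0] using h v

theorem christoffelLower_smul (hG : DifferentiableAt ℝ G y) (hr : DifferentiableAt ℝ r y)
    (u v w : E) : christoffelLower (fun z => r z • G z) y u v w =
      r y * christoffelLower G y u v w + 1 / 2 * (fderiv ℝ r y u * G y v w
        + fderiv ℝ r y v * G y u w - fderiv ℝ r y w * G y u v) := by
  have e : HasFDerivAt (fun z => r z • G z) (r y • fderiv ℝ G y + (fderiv ℝ r y).smulRight (G y))
    y := hr.hasFDerivAt.smul hG.hasFDerivAt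
  rw [christoffelLower_apply, christoffelLower_apply, e.fderiv]
  simp
  ring

end

variable [FiniteDimensional ℝ E]

theorem IsSmoothMetricAt.isInvertible {G : E → E →L[ℝ] E →L[ℝ] ℝ} {y : E}
    (h : IsSmoothMetricAt G y) : (G y).IsInvertible := by
  have hinj : Function.Injective (G y) := by
    rw [injective_iff_map_eq_zero]
    exact fun u hu => h.nondeg u fun v => by rw [hu]; rfl
  have hrank : Module.finrank ℝ E = Module.finrank ℝ (E →L[ℝ] ℝ) := by
    rw [← LinearMap.toContinuousLinearMap.finrank_eq]
    exact (Subspace.dual_finrank_eq (K := ℝ) (V := E)).symm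
  let e := LinearEquiv.ofInjectiveOfFinrankEq (G y).toLinearMap hinj hrank
  exact ⟨e.toContinuousLinearEquiv, by ext u v; rfl⟩

theorem IsSmoothMetricAt.apply_christoffel {G : E → E →L[ℝ] E →L[ℝ] ℝ} {y : E}
    (h : IsSmoothMetricAt G y) (u v : E) :
    G y (christoffel G y u v) = christoffelLower G y u v :=
  h.isInvertible.self_apply_inverse _

theorem IsSmoothMetricAt.contDiffAt_christoffelCLM {G : E → E →L[ℝ] E →L[ℝ] ℝ} {y : E}
    (h : IsSmoothMetricAt G y) : ContDiffAt ℝ ∞ (christoffelCLM G) y := by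
  have h1 : ContDiffAt ℝ ∞ (fderiv ℝ G) y := h.contDiffAt.fderiv_right (by simp)
  have h2 : ContDiffAt ℝ ∞ (fun z => (G z).inverse) y :=
    (h.isInvertible.contDiffAt_map_inverse).comp y h.contDiffAt
  have h3 : ContDiffAt ℝ ∞ (fun z => (fderiv ℝ G z).flip) y :=
    (ContinuousLinearMap.flipₗᵢ ℝ E E (E →L[ℝ] ℝ)).contDiff.contDiffAt.comp y h1
  have h4 : ContDiffAt ℝ ∞ (christoffelLowerCLM G) y := by
    unfold christoffelLowerCLM
    exact ((h1.add h3).sub (contDiffAt_const.clm_comp h3)).const_smul _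
  unfold christoffelCLM
  exact (((ContinuousLinearMap.compL ℝ E (E →L[ℝ] ℝ) E).contDiff.contDiffAt.comp y h2)).clm_comp h4

theorem curvature_eq {G : E → E →L[ℝ] E →L[ℝ] ℝ} {y : E} (h : IsSmoothMetricAt G y)
    (u v w : E) :
    curvature G y u v w = fderiv ℝ (christoffelCLM G) y u v w - fderiv ℝ (christoffelCLM G) y v u w
      + christoffelCLM G y u (christoffelCLM G y v w)
      - christoffelCLM G y v (christoffelCLM G y u w) := by
  have hd : DifferentiableAt ℝ (christoffelCLM G) y :=
    h.contDiffAt_christoffelCLM.differentiableAt (by simp)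
  have key : ∀ a b c, fderiv ℝ (fun z => christoffel G z b c) y a
      = fderiv ℝ (christoffelCLM G) y a b c := by
    intro a b c
    simp only [← christoffelCLM_apply]
    rw [((hd.hasFDerivAt.clm_apply (hasFDerivAt_const b y)).clm_apply
      (hasFDerivAt_const c y)).fderiv]
    simp
  simp only [curvature, key, christoffelCLM_apply]

/-! ### Transformation laws for the connection and the curvature. -/

section Pullback

variable {G G' : E → E →L[ℝ] E →L[ℝ] ℝ} {F : E → E} {y : E}

theorem fderiv_christoffel_pullback (hG : IsSmoothMetricAt G y)
    (hG' : IsSmoothMetricAt G' (F y)) (hF : ContDiffAt ℝ ∞ F y)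
    (hsurj : Function.Surjective (fderiv ℝ F y)) (hp : IsPullbackNear G G' F y) (u v : E) :
    fderiv ℝ F y (christoffel G y u v) =
      christoffel G' (F y) (fderiv ℝ F y u) (fderiv ℝ F y v) + fderiv ℝ (fderiv ℝ F) y u v := by
  rw [← sub_eq_zero]
  refine hG'.nondeg _ fun x => ?_
  obtain ⟨w, rfl⟩ := hsurj x
  have h1 := christoffelLower_pullback (hG.contDiffAt.differentiableAt (by simp)) hG' hF hp u v w
  rw [← hG.apply_christoffel, ← hG'.apply_christoffel, hp.self_of_nhds] at h1
  simp only [map_sub, map_add, sub_apply, add_apply]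
  linarith

/-- Differentiate the transformation law of the Christoffel symbols and antisymmetrise. The third
derivatives of `F` cancel by symmetry, and the remaining second-derivative terms cancel against
those coming from the products of Christoffel symbols. -/
theorem curvature_pullback (hG : ∀ᶠ z in 𝓝 y, IsSmoothMetricAt G z)
    (hG' : ∀ᶠ z in 𝓝 (F y), IsSmoothMetricAt G' z) (hF : ∀ᶠ z in 𝓝 y, ContDiffAt ℝ ∞ F z)
    (hsurj : ∀ᶠ z in 𝓝 y, Function.Surjective (fderiv ℝ F z)) (hp : IsPullbackNear G G' F y)
    (u v w : E) :
    fderiv ℝ F y (curvature G y u v w) =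
      curvature G' (F y) (fderiv ℝ F y u) (fderiv ℝ F y v) (fderiv ℝ F y w) := by
  have hF0 := hF.self_of_nhds
  have hfF : ContDiffAt ℝ ∞ (fderiv ℝ F) y := hF0.fderiv_right (by simp)
  have hF1 : HasFDerivAt F (fderiv ℝ F y) y := (hF0.differentiableAt (by simp)).hasFDerivAt
  have hF2 : HasFDerivAt (fderiv ℝ F) (fderiv ℝ (fderiv ℝ F) y) y :=
    (hfF.differentiableAt (by simp)).hasFDerivAt
  have hF3 : HasFDerivAt (fderiv ℝ (fderiv ℝ F)) (fderiv ℝ (fderiv ℝ (fderiv ℝ F)) y) y :=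
    ((hfF.fderiv_right (m := ∞) (by simp)).differentiableAt (by simp)).hasFDerivAt
  have hs2 : ∀ a b, fderiv ℝ (fderiv ℝ F) y a b = fderiv ℝ (fderiv ℝ F) y b a :=
    hF0.isSymmSndFDerivAt minSmoothness_two_le_infty
  have hs3 : ∀ a b, fderiv ℝ (fderiv ℝ (fderiv ℝ F)) y a b
      = fderiv ℝ (fderiv ℝ (fderiv ℝ F)) y b a := hfF.isSymmSndFDerivAt minSmoothness_two_le_infty
  have hd := (hG.self_of_nhds.contDiffAt_christoffelCLM.differentiableAt (by simp)).hasFDerivAt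
  have hd' := (hG'.self_of_nhds.contDiffAt_christoffelCLM.differentiableAt (by simp)).hasFDerivAt
  have hN : ∀ᶠ z in 𝓝 y, ∀ b c, fderiv ℝ F z (christoffelCLM G z b c) =
      christoffelCLM G' (F z) (fderiv ℝ F z b) (fderiv ℝ F z c)
        + fderiv ℝ (fderiv ℝ F) z b c := by
    filter_upwards [hG, hF1.continuousAt.eventually hG', hF, hsurj, hp.eventually_nhds]
      with z h1 h2 h3 h4 h5 b c
    simp only [christoffelCLM_apply]
    exact fderiv_christoffel_pullback h1 h2 h3 h4 h5 b c
  have key : ∀ a b c, fderiv ℝ (fderiv ℝ F) y a (christoffelCLM G y b c)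
      + fderiv ℝ F y (fderiv ℝ (christoffelCLM G) y a b c) =
      fderiv ℝ (christoffelCLM G') (F y) (fderiv ℝ F y a) (fderiv ℝ F y b) (fderiv ℝ F y c)
      + christoffelCLM G' (F y) (fderiv ℝ (fderiv ℝ F) y a b) (fderiv ℝ F y c)
      + christoffelCLM G' (F y) (fderiv ℝ F y b) (fderiv ℝ (fderiv ℝ F) y a c)
      + fderiv ℝ (fderiv ℝ (fderiv ℝ F)) y a b c := by
    intro a b c
    have e1 := hF2.clm_apply
      ((hd.clm_apply (hasFDerivAt_const b y)).clm_apply (hasFDerivAt_const c y))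
    have e2 := (((hd'.comp y hF1).clm_apply
      (hF2.clm_apply (hasFDerivAt_const b y))).clm_apply
      (hF2.clm_apply (hasFDerivAt_const c y))).add
      ((hF3.clm_apply (hasFDerivAt_const b y)).clm_apply (hasFDerivAt_const c y))
    have e3 := e2.congr_of_eventuallyEq (hN.mono fun z hz => hz b c)
    have e4 := congrArg (fun L : E →L[ℝ] E => L a) (e1.unique e3)
    simp at e4
    rw [add_comm, e4]
    abel
  have hN0 := hN.self_of_nhds
  rw [curvature_eq hG.self_of_nhds, curvature_eq hG'.self_of_nhds]
  simp only [map_add, map_sub, hN0]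
  have k1 := key u v w
  have k2 := key v u w
  rw [hs3 v u, hs2 v u] at k2
  linear_combination (norm := module) (1 : ℝ) • k1 - (1 : ℝ) • k2

/-- Obtained by differentiating `J' ∘ DF = ε • DF ∘ J`. The constant `ε` need only be nonzero, so
holomorphic and antiholomorphic maps are treated together. -/
theorem covDerivEnd_pullback {J J' : E → E →L[ℝ] E} {ε : ℝ} (hε : ε ≠ 0)
    (hG : IsSmoothMetricAt G y) (hG' : IsSmoothMetricAt G' (F y)) (hF : ContDiffAt ℝ ∞ F y)
    (hbij : Function.Bijective (fderiv ℝ F y)) (hp : IsPullbackNear G G' F y)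
    (hJ : DifferentiableAt ℝ J y) (hJ' : DifferentiableAt ℝ J' (F y))
    (hFJ : ∀ᶠ z in 𝓝 y, ∀ v, J' (F z) (fderiv ℝ F z v) = ε • fderiv ℝ F z (J z v))
    (hpar : ∀ u v, covDerivEnd G' J' (F y) u v = 0) (u v : E) : covDerivEnd G J y u v = 0 := by
  have hF1 : HasFDerivAt F (fderiv ℝ F y) y := (hF.differentiableAt (by simp)).hasFDerivAt
  have hF2 : HasFDerivAt (fderiv ℝ F) (fderiv ℝ (fderiv ℝ F) y) y :=
    ((hF.fderiv_right (m := ∞) (by simp)).differentiableAt (by simp)).hasFDerivAt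
  have e1 := (hJ'.hasFDerivAt.comp y hF1).clm_apply (hF2.clm_apply (hasFDerivAt_const v y))
  have e2 := (hF2.clm_apply (hJ.hasFDerivAt.clm_apply (hasFDerivAt_const v y))).const_smul ε
  have e3 := e2.congr_of_eventuallyEq (hFJ.mono fun z hz => hz v)
  have e4 := congrArg (fun L : E →L[ℝ] E => L u) (e1.unique e3)
  simp at e4
  have h0 := hFJ.self_of_nhds
  have hN := fderiv_christoffel_pullback hG hG' hF hbij.2 hp
  have h1 := hpar (fderiv ℝ F y u) (fderiv ℝ F y v)
  rw [covDerivEnd, h0, ← christoffelCLM_apply, map_smul, christoffelCLM_apply] at h1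
  refine hbij.1 ((smul_right_injective E hε) ?_)
  have h3 := h0 (christoffel G y u v)
  rw [hN, map_add] at h3
  simp only [covDerivEnd, map_add, map_sub, hN, map_zero]
  linear_combination (norm := module) (1 : ℝ) • h1 - (1 : ℝ) • e4 + (1 : ℝ) • h3

end Pullback

/-! ### Conformal changes of a Kähler metric. -/

section Conformal

variable {G : E → E →L[ℝ] E →L[ℝ] ℝ} {y : E} {r : E → ℝ}

/-- If the complex structure `J` is parallel for two conformal metrics for which it is orthogonal,
then the conformal factor is stationary. -/
theorem fderiv_eq_zero_of_conformal (hdim : 3 ≤ Module.finrank ℝ E) {J : E → E →L[ℝ] E}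
    (hG : IsSmoothMetricAt G y) (hr : ContDiffAt ℝ ∞ r y) (hr0 : r y ≠ 0)
    (hJ : ∀ v, J y (J y v) = -v) (horth : ∀ u v, G y (J y u) (J y v) = G y u v)
    (h1 : ∀ u v, covDerivEnd G J y u v = 0)
    (h2 : ∀ u v, covDerivEnd (fun z => r z • G z) J y u v = 0) : fderiv ℝ r y = 0 := by
  have hG₂ := hG.smul hr hr0
  have hskew : ∀ a b, G y (J y a) b = -G y a (J y b) := by
    intro a b
    rw [← horth a, hJ]
    simp
  have hδ : ∀ u v w, r y * G y (christoffel (fun z => r z • G z) y u v - christoffel G y u v) w =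
      1 / 2 * (fderiv ℝ r y u * G y v w + fderiv ℝ r y v * G y u w - fderiv ℝ r y w * G y u v) := by
    intro u v w
    have e := christoffelLower_smul (hG.contDiffAt.differentiableAt (by simp))
      (hr.differentiableAt (by simp)) u v w
    rw [← hG.apply_christoffel, ← hG₂.apply_christoffel] at e
    simp only [smul_apply, smul_eq_mul] at e
    simp only [map_sub, sub_apply]
    linear_combination e
  ext v
  -- Orthogonality of `u` to `v` and `J v` removes the terms of the difference tensor that contain
  -- `dr(w)` and `dr(J w)`. Commutation with `J` then reduces to `dr(J v) u = dr(v) J u`, and `u`,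
  -- `J u` are independent.
  obtain ⟨u, hu0, huv, huJ⟩ := exists_ne_zero_orthogonal hdim ((G y).flip v) ((G y).flip (J y v))
  simp only [ContinuousLinearMap.flip_apply] at huv huJ
  have hcomm : christoffel (fun z => r z • G z) y u (J y v) - christoffel G y u (J y v) =
      J y (christoffel (fun z => r z • G z) y u v - christoffel G y u v) := by
    have e1 := h1 u v
    have e2 := h2 u v
    simp only [covDerivEnd] at e1 e2
    rw [map_sub]
    linear_combination (norm := module) (1 : ℝ) • e2 - (1 : ℝ) • e1
  have hz : fderiv ℝ r y (J y v) • u + (-fderiv ℝ r y v) • J y u = 0 := by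
    refine hG.nondeg _ fun w => ?_
    have e1 := hδ u (J y v) w
    have e2 := hδ u v (J y w)
    rw [hcomm, hskew] at e1
    rw [huJ, hskew] at e1
    rw [huv] at e2
    simp only [map_add, map_smul, add_apply, smul_apply, smul_eq_mul, hskew]
    linear_combination -2 * e1 - 2 * e2
  have := (coeff_eq_zero_of_mem (L := ⊥) (y := u) hJ
    (fun z hz => by simp [(Submodule.mem_bot ℝ).1 hz]) (by simpa using hu0)
    (by rw [hz]; exact Submodule.zero_mem _)).2
  simpa using this

/-- A constant factor cancels between the inverse metric and the lower Christoffel symbol, so the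
connection is unchanged. -/
theorem curvature_smul_const (c : ℝ) (hc : c ≠ 0) (hG : ∀ᶠ z in 𝓝 y, IsSmoothMetricAt G z)
    (u v w : E) : curvature (fun z => c • G z) y u v w = curvature G y u v w := by
  have h : ∀ᶠ z in 𝓝 y, ∀ u v, christoffel (fun z => c • G z) z u v = christoffel G z u v := by
    filter_upwards [hG] with z hz u v
    have hz₂ := hz.smul (contDiffAt_const (c := c)) hc
    rw [← sub_eq_zero]
    refine hz.nondeg _ fun w => ?_
    have e := christoffelLower_smul (hz.contDiffAt.differentiableAt (by simp))
      (differentiableAt_const c) u v w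
    rw [← hz.apply_christoffel, ← hz₂.apply_christoffel] at e
    simp only [smul_apply, smul_eq_mul, fderiv_fun_const, Pi.zero_apply, zero_apply] at e
    simp only [map_sub, sub_apply]
    refine (mul_eq_zero.1 (?_ : c * _ = 0)).resolve_left hc
    linear_combination e
  have hd : ∀ a b, fderiv ℝ (fun z => christoffel (fun z => c • G z) z a b) y
      = fderiv ℝ (fun z => christoffel G z a b) y := fun a b =>
    Filter.EventuallyEq.fderiv_eq (h.mono fun z hz => hz a b)
  simp only [curvature, hd, h.self_of_nhds]

end Conformal

end LocalGeometry

/-! ### Tensor fields in charts -/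

section Charts

variable {E : Type*} [NormedAddCommGroup E] [NormedSpace ℝ E]
  {M : Type*} [TopologicalSpace M] [ChartedSpace E M]

/-- The derivative of the inverse of the chart at `p`. -/
def chartSymmDeriv (p : M) (y : E) : E →L[ℝ] E :=
  mfderiv 𝓘(ℝ, E) 𝓘(ℝ, E) (extChartAt 𝓘(ℝ, E) p).symm y

/-- The derivative of the chart at `p`. -/
def chartDeriv (p q : M) : E →L[ℝ] E :=
  mfderiv 𝓘(ℝ, E) 𝓘(ℝ, E) (extChartAt 𝓘(ℝ, E) p) q

theorem bilinInChart_apply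
    (g : ∀ q : M, TangentSpace 𝓘(ℝ, E) q →L[ℝ] TangentSpace 𝓘(ℝ, E) q →L[ℝ] ℝ) (p : M)
    (y u v : E) : bilinInChart g p y u v =
      g ((extChartAt 𝓘(ℝ, E) p).symm y) (chartSymmDeriv p y u) (chartSymmDeriv p y v) := rfl

theorem endInChart_apply (A : ∀ q : M, TangentSpace 𝓘(ℝ, E) q →L[ℝ] TangentSpace 𝓘(ℝ, E) q)
    (p : M) (y u : E) : endInChart A p y u =
      chartDeriv (E := E) p ((extChartAt 𝓘(ℝ, E) p).symm y)
        (A ((extChartAt 𝓘(ℝ, E) p).symm y) (chartSymmDeriv p y u)) := rfl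

variable [IsManifold 𝓘(ℝ, E) ∞ M]

theorem chartDeriv_chartSymmDeriv {p : M} {y : E} (hy : y ∈ (extChartAt 𝓘(ℝ, E) p).target)
    (u : E) : chartDeriv p ((extChartAt 𝓘(ℝ, E) p).symm y) (chartSymmDeriv p y u) = u := by
  have h := mfderiv_extChartAt_comp_mfderivWithin_extChartAt_symm hy
  simp only [modelWithCornersSelf_coe, range_id, mfderivWithin_univ] at h
  exact congrArg (fun L : E →L[ℝ] E => L u) h

theorem chartSymmDeriv_chartDeriv {p : M} {y : E} (hy : y ∈ (extChartAt 𝓘(ℝ, E) p).target)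
    (u : E) : chartSymmDeriv p y (chartDeriv p ((extChartAt 𝓘(ℝ, E) p).symm y) u) = u := by
  have h := mfderivWithin_extChartAt_symm_comp_mfderiv_extChartAt hy
  simp only [modelWithCornersSelf_coe, range_id, mfderivWithin_univ] at h
  exact congrArg (fun L : E →L[ℝ] E => L u) h

/-- Tangent vectors at `p` are identified with their components in the chart at `p`; hence formulas
in this chart need no correction at its centre. -/
theorem chartSymmDeriv_self (p : M) :
    chartSymmDeriv p (extChartAt 𝓘(ℝ, E) p p) = ContinuousLinearMap.id ℝ E := by
  have h := mfderivWithin_range_extChartAt_symm (I := 𝓘(ℝ, E)) (x := p)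
  simp only [modelWithCornersSelf_coe, range_id, mfderivWithin_univ] at h
  exact h

theorem contMDiffAt_extChartAt_symm {p : M} {y : E} (hy : y ∈ (extChartAt 𝓘(ℝ, E) p).target) :
    ContMDiffAt 𝓘(ℝ, E) 𝓘(ℝ, E) ∞ (extChartAt 𝓘(ℝ, E) p).symm y :=
  (contMDiffOn_extChartAt_symm p).contMDiffAt ((isOpen_extChartAt_target p).mem_nhds hy)

theorem symmL_trivializationAt_eq {p : M} {y : E} (hy : y ∈ (extChartAt 𝓘(ℝ, E) p).target)
    (u : E) : (trivializationAt E (TangentSpace 𝓘(ℝ, E)) p).symmL ℝ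
      ((extChartAt 𝓘(ℝ, E) p).symm y) u = chartSymmDeriv p y u := by
  have hq : (extChartAt 𝓘(ℝ, E) p).symm y ∈ (chartAt E p).source := by
    rw [← extChartAt_source (I := 𝓘(ℝ, E))]
    exact (extChartAt 𝓘(ℝ, E) p).map_target hy
  have h := TangentBundle.symmL_trivializationAt (I := 𝓘(ℝ, E)) hq
  simp only [modelWithCornersSelf_coe, range_id, mfderivWithin_univ] at h
  have h2 : chartSymmDeriv p (extChartAt 𝓘(ℝ, E) p ((extChartAt 𝓘(ℝ, E) p).symm y)) u =
      chartSymmDeriv p y u := by rw [(extChartAt 𝓘(ℝ, E) p).right_inv hy]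
  exact (congrArg (fun L : E →L[ℝ] E => L u) h).trans h2

theorem contDiffAt_bilinInChart
    {g : ∀ q : M, TangentSpace 𝓘(ℝ, E) q →L[ℝ] TangentSpace 𝓘(ℝ, E) q →L[ℝ] ℝ}
    (hg : ContMDiff 𝓘(ℝ, E) (𝓘(ℝ, E).prod 𝓘(ℝ, E →L[ℝ] E →L[ℝ] ℝ)) ∞
      (fun p ↦ TotalSpace.mk' (E →L[ℝ] E →L[ℝ] ℝ)
        (E := fun q : M ↦ TangentSpace 𝓘(ℝ, E) q →L[ℝ] TangentSpace 𝓘(ℝ, E) q →L[ℝ] ℝ) p (g p)))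
    {p : M} {y : E} (hy : y ∈ (extChartAt 𝓘(ℝ, E) p).target) :
    ContDiffAt ℝ ∞ (bilinInChart g p) y := by
  have hsrc : ∀ z ∈ (extChartAt 𝓘(ℝ, E) p).target,
      (extChartAt 𝓘(ℝ, E) p).symm z ∈ (trivializationAt E (TangentSpace 𝓘(ℝ, E)) p).baseSet := by
    intro z hz
    rw [TangentBundle.trivializationAt_baseSet, ← extChartAt_source (I := 𝓘(ℝ, E))]
    exact (extChartAt 𝓘(ℝ, E) p).map_target hz
  have h1 := ((trivializationAt (E →L[ℝ] E →L[ℝ] ℝ) (fun q : M ↦ TangentSpace 𝓘(ℝ, E) q →L[ℝ]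
    TangentSpace 𝓘(ℝ, E) q →L[ℝ] ℝ) p).contMDiffAt_section_iff
      (x₀ := (extChartAt 𝓘(ℝ, E) p).symm y) (by simpa using hsrc y hy)).1 (hg _)
  have h2 := (h1.comp y (contMDiffAt_extChartAt_symm hy)).contDiffAt
  refine h2.congr_of_eventuallyEq ?_
  filter_upwards [(isOpen_extChartAt_target p).mem_nhds hy] with z hz
  ext u v
  rw [bilinInChart_apply, Function.comp_apply, hom_trivializationAt_apply,
    inCoordinates_apply_eq₂ (hsrc z hz) (hsrc z hz) (by simp),
    ← Trivialization.symmL_apply (R := ℝ) _ (hsrc z hz),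
    ← Trivialization.symmL_apply (R := ℝ) _ (hsrc z hz), symmL_trivializationAt_eq hz, symmL_trivializationAt_eq hz]
  simp

theorem contDiffAt_endInChart
    {A : ∀ q : M, TangentSpace 𝓘(ℝ, E) q →L[ℝ] TangentSpace 𝓘(ℝ, E) q}
    (hA : ContMDiff 𝓘(ℝ, E) (𝓘(ℝ, E).prod 𝓘(ℝ, E →L[ℝ] E)) ∞
      (fun p ↦ TotalSpace.mk' (E →L[ℝ] E)
        (E := fun q : M ↦ TangentSpace 𝓘(ℝ, E) q →L[ℝ] TangentSpace 𝓘(ℝ, E) q) p (A p)))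
    {p : M} {y : E} (hy : y ∈ (extChartAt 𝓘(ℝ, E) p).target) :
    ContDiffAt ℝ ∞ (endInChart A p) y := by
  have hsrc : ∀ z ∈ (extChartAt 𝓘(ℝ, E) p).target,
      (extChartAt 𝓘(ℝ, E) p).symm z ∈ (chartAt E p).source := by
    intro z hz
    rw [← extChartAt_source (I := 𝓘(ℝ, E))]
    exact (extChartAt 𝓘(ℝ, E) p).map_target hz
  have h1 := ((trivializationAt (E →L[ℝ] E) (fun q : M ↦ TangentSpace 𝓘(ℝ, E) q →L[ℝ]
    TangentSpace 𝓘(ℝ, E) q) p).contMDiffAt_section_iff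
      (x₀ := (extChartAt 𝓘(ℝ, E) p).symm y) (by simpa using hsrc y hy)).1 (hA _)
  have h2 := (h1.comp y (contMDiffAt_extChartAt_symm hy)).contDiffAt
  refine h2.congr_of_eventuallyEq ?_
  filter_upwards [(isOpen_extChartAt_target p).mem_nhds hy] with z hz
  ext u
  rw [endInChart_apply, Function.comp_apply, hom_trivializationAt_apply]
  simp only [ContinuousLinearMap.inCoordinates,
    TangentBundle.continuousLinearMapAt_trivializationAt (hsrc z hz)]
  have h3 := symmL_trivializationAt_eq hz u
  rw [← h3]
  rfl

end Charts

/-! ### Indefinite Kähler structures at a point and in a chart -/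

namespace IndefiniteKaehler

variable {E : Type*} [NormedAddCommGroup E] [NormedSpace ℝ E]
  {M : Type*} [TopologicalSpace M] [ChartedSpace E M] [IsManifold 𝓘(ℝ, E) ∞ M]
  (K : IndefiniteKaehler E M)

/-- The metric at `p` as a bilinear form on the model space. -/
def metricAt (p : M) : E →L[ℝ] E →L[ℝ] ℝ := K.g p

/-- The complex structure at `p` as an endomorphism of the model space. -/
def complexAt (p : M) : E →L[ℝ] E := K.J p

/-- The complex structure in the chart at `p`. -/
def JChart (p : M) : E → E →L[ℝ] E := endInChart K.J p

theorem metricAt_symm (p : M) (x y : E) : K.metricAt p x y = K.metricAt p y x := K.g_symm p x y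

theorem metricAt_nondeg (p : M) (x : E) (h : ∀ y, K.metricAt p x y = 0) : x = 0 :=
  K.g_nondegenerate p x h

theorem metricAt_indefinite (p : M) :
    (∃ x, 0 < K.metricAt p x x) ∧ ∃ x, K.metricAt p x x < 0 := K.g_indefinite p

theorem complexAt_sq (p : M) (x : E) : K.complexAt p (K.complexAt p x) = -x := K.J_sq p x

theorem metricAt_complexAt (p : M) (x y : E) :
    K.metricAt p (K.complexAt p x) (K.complexAt p y) = K.metricAt p x y := K.J_orthogonal p x y

theorem metricAt_self_complexAt (p : M) (x : E) : K.metricAt p x (K.complexAt p x) = 0 := by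
  have h := K.metricAt_complexAt p x (K.complexAt p x)
  rw [complexAt_sq, map_neg, metricAt_symm] at h
  linarith

theorem gChart_apply (p : M) (y u v : E) : K.gChart p y u v =
    K.metricAt ((extChartAt 𝓘(ℝ, E) p).symm y) (chartSymmDeriv p y u) (chartSymmDeriv p y v) := rfl

theorem JChart_apply (p : M) (y u : E) : K.JChart p y u =
    chartDeriv p ((extChartAt 𝓘(ℝ, E) p).symm y)
      (K.complexAt ((extChartAt 𝓘(ℝ, E) p).symm y) (chartSymmDeriv p y u)) := rfl

theorem gChart_self (p : M) : K.gChart p (extChartAt 𝓘(ℝ, E) p p) = K.metricAt p := by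
  ext u v
  rw [gChart_apply, chartSymmDeriv_self, extChartAt_to_inv]
  rfl

variable {K} {p : M} {y : E}

theorem isSmoothMetricAt_gChart (hy : y ∈ (extChartAt 𝓘(ℝ, E) p).target) :
    LocalGeometry.IsSmoothMetricAt (K.gChart p) y where
  contDiffAt := contDiffAt_bilinInChart K.g_smooth hy
  symm u v := K.metricAt_symm _ _ _
  nondeg u h := by
    have h1 : chartSymmDeriv p y u = 0 := by
      refine K.metricAt_nondeg ((extChartAt 𝓘(ℝ, E) p).symm y) _ fun x => ?_
      have := h (chartDeriv p ((extChartAt 𝓘(ℝ, E) p).symm y) x)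
      rwa [gChart_apply, chartSymmDeriv_chartDeriv hy] at this
    rw [← chartDeriv_chartSymmDeriv hy u, h1, map_zero]

theorem contDiffAt_JChart (hy : y ∈ (extChartAt 𝓘(ℝ, E) p).target) :
    ContDiffAt ℝ ∞ (K.JChart p) y :=
  contDiffAt_endInChart K.J_smooth hy

theorem JChart_sq (hy : y ∈ (extChartAt 𝓘(ℝ, E) p).target) (u : E) :
    K.JChart p y (K.JChart p y u) = -u := by
  rw [JChart_apply, JChart_apply, chartSymmDeriv_chartDeriv hy]
  rw [complexAt_sq, map_neg, chartDeriv_chartSymmDeriv hy]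

theorem gChart_JChart (hy : y ∈ (extChartAt 𝓘(ℝ, E) p).target) (u v : E) :
    K.gChart p y (K.JChart p y u) (K.JChart p y v) = K.gChart p y u v := by
  rw [gChart_apply, JChart_apply, JChart_apply, chartSymmDeriv_chartDeriv hy,
    chartSymmDeriv_chartDeriv hy, metricAt_complexAt, gChart_apply]

theorem holSectional_eq (p : M) (x : E) :
    K.holSectional p x =
      K.R p x (K.complexAt p x) (K.complexAt p x) x / K.metricAt p x x ^ 2 := by
  change K.R p x (K.complexAt p x) (K.complexAt p x) x / (K.metricAt p x x *
    K.metricAt p (K.complexAt p x) (K.complexAt p x) -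
    K.metricAt p x (K.complexAt p x) * K.metricAt p (K.complexAt p x) x) = _
  rw [metricAt_complexAt, metricAt_self_complexAt, zero_mul, sub_zero, pow_two]

variable [FiniteDimensional ℝ E]

theorem R_eq (p : M) (x y z u : E) : K.R p x y z u = K.metricAt p
    (fderiv ℝ (LocalGeometry.christoffelCLM (K.gChart p)) (extChartAt 𝓘(ℝ, E) p p) x y z
      - fderiv ℝ (LocalGeometry.christoffelCLM (K.gChart p)) (extChartAt 𝓘(ℝ, E) p p) y x z
      + LocalGeometry.christoffelCLM (K.gChart p) (extChartAt 𝓘(ℝ, E) p p) x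
        (LocalGeometry.christoffelCLM (K.gChart p) (extChartAt 𝓘(ℝ, E) p p) y z)
      - LocalGeometry.christoffelCLM (K.gChart p) (extChartAt 𝓘(ℝ, E) p p) y
        (LocalGeometry.christoffelCLM (K.gChart p) (extChartAt 𝓘(ℝ, E) p p) x z)) u := by
  rw [← LocalGeometry.curvature_eq (isSmoothMetricAt_gChart (mem_extChartAt_target p))]
  rfl

/-- The quadrilinear form whose diagonal is the numerator of the holomorphic sectional curvature. -/
theorem isQuadrilinear_R (p : M) :
    IsQuadrilinear (fun x y z u : E => K.R p x (K.complexAt p y) (K.complexAt p z) u) := by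
  constructor <;> intros <;>
    simp only [R_eq, map_add, map_sub, map_smul, add_apply, sub_apply, smul_apply, smul_eq_mul] <;>
    ring

theorem continuous_R (p : M) :
    Continuous (fun x : E => K.R p x (K.complexAt p x) (K.complexAt p x) x) := by
  simp only [R_eq]
  fun_prop

end IndefiniteKaehler

/-! ### Diffeomorphisms in charts -/

section Diffeo

variable {E : Type*} [NormedAddCommGroup E] [NormedSpace ℝ E]
  {M : Type*} [TopologicalSpace M] [ChartedSpace E M] [IsManifold 𝓘(ℝ, E) ∞ M]
  {M' : Type*} [TopologicalSpace M'] [ChartedSpace E M'] [IsManifold 𝓘(ℝ, E) ∞ M']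
  (f : M ≃ₘ^∞⟮𝓘(ℝ, E), 𝓘(ℝ, E)⟯ M')

/-- The differential of `f` at `p` as an endomorphism of the model space. -/
def diffAt (p : M) : E →L[ℝ] E := push f p

/-- The expression of `f` in the charts at `p` and `f p`. -/
def chartRep (p : M) (y : E) : E :=
  extChartAt 𝓘(ℝ, E) (f p) (f ((extChartAt 𝓘(ℝ, E) p).symm y))

/-- The domain of `chartRep f p`. -/
def chartRepDomain (p : M) : Set E :=
  (extChartAt 𝓘(ℝ, E) p).target ∩
    (extChartAt 𝓘(ℝ, E) p).symm ⁻¹' (f ⁻¹' (extChartAt 𝓘(ℝ, E) (f p)).source)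

omit [IsManifold 𝓘(ℝ, E) ∞ M] [IsManifold 𝓘(ℝ, E) ∞ M'] in
theorem isOpen_chartRepDomain (p : M) : IsOpen (chartRepDomain f p) :=
  (continuousOn_extChartAt_symm p).isOpen_inter_preimage (isOpen_extChartAt_target p)
    ((isOpen_extChartAt_source (f p)).preimage f.continuous)

omit [IsManifold 𝓘(ℝ, E) ∞ M] [IsManifold 𝓘(ℝ, E) ∞ M'] in
theorem mem_chartRepDomain_self (p : M) : extChartAt 𝓘(ℝ, E) p p ∈ chartRepDomain f p :=
  ⟨mem_extChartAt_target p, by simp⟩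

omit [IsManifold 𝓘(ℝ, E) ∞ M] [IsManifold 𝓘(ℝ, E) ∞ M'] in
theorem chartRep_self (p : M) :
    chartRep f p (extChartAt 𝓘(ℝ, E) p p) = extChartAt 𝓘(ℝ, E) (f p) (f p) := by
  simp [chartRep]

omit [IsManifold 𝓘(ℝ, E) ∞ M] [IsManifold 𝓘(ℝ, E) ∞ M'] in
theorem diffAt_bijective (p : M) : Function.Bijective (diffAt f p) :=
  (f.mfderivToContinuousLinearEquiv (by simp) p).bijective

variable {f} {p : M} {y : E}

omit [IsManifold 𝓘(ℝ, E) ∞ M] [IsManifold 𝓘(ℝ, E) ∞ M'] in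
theorem chartRep_mem_target (hy : y ∈ chartRepDomain f p) :
    chartRep f p y ∈ (extChartAt 𝓘(ℝ, E) (f p)).target :=
  (extChartAt 𝓘(ℝ, E) (f p)).map_source hy.2

omit [IsManifold 𝓘(ℝ, E) ∞ M] [IsManifold 𝓘(ℝ, E) ∞ M'] in
theorem symm_chartRep (hy : y ∈ chartRepDomain f p) :
    (extChartAt 𝓘(ℝ, E) (f p)).symm (chartRep f p y) = f ((extChartAt 𝓘(ℝ, E) p).symm y) :=
  (extChartAt 𝓘(ℝ, E) (f p)).left_inv hy.2

theorem contDiffAt_chartRep (hy : y ∈ chartRepDomain f p) :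
    ContDiffAt ℝ ∞ (chartRep f p) y := by
  have h1 : ContMDiffAt 𝓘(ℝ, E) 𝓘(ℝ, E) ∞ (extChartAt 𝓘(ℝ, E) (f p))
      (f ((extChartAt 𝓘(ℝ, E) p).symm y)) := contMDiffAt_extChartAt' (by simpa using hy.2)
  exact (h1.comp y ((f.contMDiff _).comp y (contMDiffAt_extChartAt_symm hy.1))).contDiffAt

theorem fderiv_chartRep (hy : y ∈ chartRepDomain f p) (u : E) :
    fderiv ℝ (chartRep f p) y u = chartDeriv (f p) (f ((extChartAt 𝓘(ℝ, E) p).symm y))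
      (diffAt f ((extChartAt 𝓘(ℝ, E) p).symm y) (chartSymmDeriv p y u)) := by
  have h1 := (contMDiffAt_extChartAt' (I := 𝓘(ℝ, E)) (n := ∞) (x := f p)
    (x' := f ((extChartAt 𝓘(ℝ, E) p).symm y)) (by simpa using hy.2)).mdifferentiableAt (by simp)
  have h2 := (f.contMDiff ((extChartAt 𝓘(ℝ, E) p).symm y)).mdifferentiableAt (by simp)
  have h3 := (contMDiffAt_extChartAt_symm hy.1).mdifferentiableAt (by simp)
  have h4 := h1.hasMFDerivAt.comp y (h2.hasMFDerivAt.comp y h3.hasMFDerivAt)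
  have h5 : mfderiv 𝓘(ℝ, E) 𝓘(ℝ, E) (chartRep f p) y = _ := h4.mfderiv
  rw [mfderiv_eq_fderiv] at h5
  exact congrArg (fun L : E →L[ℝ] E => L u) h5

theorem chartSymmDeriv_fderiv_chartRep (hy : y ∈ chartRepDomain f p) (u : E) :
    chartSymmDeriv (f p) (chartRep f p y) (fderiv ℝ (chartRep f p) y u) =
      diffAt f ((extChartAt 𝓘(ℝ, E) p).symm y) (chartSymmDeriv p y u) := by
  rw [fderiv_chartRep hy, ← symm_chartRep hy, chartSymmDeriv_chartDeriv (chartRep_mem_target hy)]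

theorem fderiv_chartRep_bijective [FiniteDimensional ℝ E] (hy : y ∈ chartRepDomain f p) :
    Function.Bijective (fderiv ℝ (chartRep f p) y) := by
  have hinj : Function.Injective (fderiv ℝ (chartRep f p) y).toLinearMap := by
    intro u v huv
    have h := congrArg (chartSymmDeriv (f p) (chartRep f p y)) huv
    simp only [ContinuousLinearMap.coe_coe, chartSymmDeriv_fderiv_chartRep hy] at h
    rw [← chartDeriv_chartSymmDeriv hy.1 u, (diffAt_bijective f _).1 h,
      chartDeriv_chartSymmDeriv hy.1]
  exact ⟨hinj, LinearMap.injective_iff_surjective.1 hinj⟩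

theorem fderiv_chartRep_self (p : M) :
    fderiv ℝ (chartRep f p) (extChartAt 𝓘(ℝ, E) p p) = diffAt f p := by
  ext1 u
  have h := chartSymmDeriv_fderiv_chartRep (mem_chartRepDomain_self f p) u
  rw [chartRep_self, chartSymmDeriv_self, chartSymmDeriv_self, extChartAt_to_inv] at h
  exact h

omit [IsManifold 𝓘(ℝ, E) ∞ M] [IsManifold 𝓘(ℝ, E) ∞ M'] in
/-- A subset of `M` which in every chart is, near the centre, the zero set of a family of
continuous functions, is closed. -/
theorem isClosed_of_chart {ι X : Type*} [TopologicalSpace X] [T1Space X] [Zero X] {S : Set M}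
    (k : M → ι → E → X) (hc : ∀ p i, ContinuousAt (k p i) (extChartAt 𝓘(ℝ, E) p p))
    (h1 : ∀ p, ∀ y ∈ chartRepDomain f p, (extChartAt 𝓘(ℝ, E) p).symm y ∈ S ↔ ∀ i, k p i y = 0) :
    IsClosed S := by
  rw [isClosed_iff_frequently]
  intro p hp
  have hself := h1 p _ (mem_chartRepDomain_self f p)
  rw [extChartAt_to_inv] at hself
  refine hself.2 fun i => ?_
  by_contra hne
  have hcont : ContinuousAt (fun q => k p i (extChartAt 𝓘(ℝ, E) p q)) p :=
    (hc p i).comp (continuousAt_extChartAt (I := 𝓘(ℝ, E)) p)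
  have hdom : ∀ᶠ q in 𝓝 p, extChartAt 𝓘(ℝ, E) p q ∈ chartRepDomain f p :=
    (continuousAt_extChartAt (I := 𝓘(ℝ, E)) p).eventually
      ((isOpen_chartRepDomain f p).mem_nhds (mem_chartRepDomain_self f p))
  obtain ⟨q, hqS, hq1, hq2, hq3⟩ := (hp.and_eventually ((hcont.eventually_ne hne).and
    (hdom.and (extChartAt_source_mem_nhds (I := 𝓘(ℝ, E)) p)))).exists
  refine hq1 ((h1 p _ hq2).1 ?_ i)
  rwa [(extChartAt 𝓘(ℝ, E) p).left_inv hq3]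

end Diffeo

/-! ### Maps preserving holomorphic planes -/

section Main

variable {E : Type*} [NormedAddCommGroup E] [NormedSpace ℝ E] [FiniteDimensional ℝ E]
  {M : Type*} [TopologicalSpace M] [ChartedSpace E M] [IsManifold 𝓘(ℝ, E) ∞ M]
  {M' : Type*} [TopologicalSpace M'] [ChartedSpace E M'] [IsManifold 𝓘(ℝ, E) ∞ M']
  {K : IndefiniteKaehler E M} {K' : IndefiniteKaehler E M'}
  {f : M ≃ₘ^∞⟮𝓘(ℝ, E), 𝓘(ℝ, E)⟯ M'}

open LocalGeometry IndefiniteKaehler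

/-- The map `f` is complex linear up to the factor `ε` at `p`. -/
def IsComplexLinearAt (K : IndefiniteKaehler E M) (K' : IndefiniteKaehler E M')
    (f : M ≃ₘ^∞⟮𝓘(ℝ, E), 𝓘(ℝ, E)⟯ M') (ε : ℝ) (p : M) : Prop :=
  ∀ v : E, K'.complexAt (f p) (diffAt f p v) = ε • diffAt f p (K.complexAt p v)

theorem isComplexLinearAt_one_or_neg_one (hdim : 3 ≤ Module.finrank ℝ E)
    (hf : PreservesHolPlanes K K' f) (p : M) :
    IsComplexLinearAt K K' f 1 p ∨ IsComplexLinearAt K K' f (-1) p := by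
  let e : E ≃L[ℝ] E := f.mfderivToContinuousLinearEquiv (by simp) p
  have he : ∀ v, e v = diffAt f p v := fun v => rfl
  let A : E →L[ℝ] E := (e.symm : E →L[ℝ] E) ∘L K'.complexAt (f p) ∘L (e : E →L[ℝ] E)
  have heA : ∀ v, diffAt f p (A v) = K'.complexAt (f p) (diffAt f p v) := fun v => by
    rw [← he, ← he]; simp [A]
  have key := eq_or_eq_neg_of_mem_span hdim (J := K.complexAt p) (A := A) (K.complexAt_sq p)
    (fun x => (diffAt_bijective f p).1 (by rw [heA, heA, complexAt_sq, map_neg]))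
    (fun x hx => by
      have h1 : K'.complexAt (f p) (diffAt f p x) ∈
          (Submodule.span ℝ {x, K.complexAt p x}).map (diffAt f p).toLinearMap := by
        have h2 := hf p x hx
        have h3 : (((Submodule.span ℝ {x, K.complexAt p x}).map (diffAt f p).toLinearMap).map
          (K'.complexAt (f p)).toLinearMap) =
            (Submodule.span ℝ {x, K.complexAt p x}).map (diffAt f p).toLinearMap := h2
        rw [← h3]
        exact Submodule.mem_map_of_mem (Submodule.mem_map_of_mem (Submodule.subset_span (by simp)))
      obtain ⟨w, hw, hw2⟩ := h1
      rw [← heA] at hw2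
      rwa [← (diffAt_bijective f p).1 hw2])
  rcases key with h | h
  · exact Or.inl fun v => by rw [← heA, h, one_smul]
  · exact Or.inr fun v => by rw [← heA, h, map_neg, neg_one_smul]

theorem JChart_chartRep {p : M} {y : E} (hy : y ∈ chartRepDomain f p) (u : E) :
    K'.JChart (f p) (chartRep f p y) (fderiv ℝ (chartRep f p) y u) =
      chartDeriv (f p) (f ((extChartAt 𝓘(ℝ, E) p).symm y))
        (K'.complexAt (f ((extChartAt 𝓘(ℝ, E) p).symm y))
          (diffAt f ((extChartAt 𝓘(ℝ, E) p).symm y) (chartSymmDeriv p y u))) := by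
  rw [JChart_apply, chartSymmDeriv_fderiv_chartRep hy, symm_chartRep hy]

theorem fderiv_chartRep_JChart {p : M} {y : E} (hy : y ∈ chartRepDomain f p) (u : E) :
    fderiv ℝ (chartRep f p) y (K.JChart p y u) =
      chartDeriv (f p) (f ((extChartAt 𝓘(ℝ, E) p).symm y))
        (diffAt f ((extChartAt 𝓘(ℝ, E) p).symm y)
          (K.complexAt ((extChartAt 𝓘(ℝ, E) p).symm y) (chartSymmDeriv p y u))) := by
  rw [fderiv_chartRep hy, JChart_apply, chartSymmDeriv_chartDeriv hy.1]

theorem isComplexLinearAt_iff_chart {ε : ℝ} {p : M} {y : E} (hy : y ∈ chartRepDomain f p) :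
    IsComplexLinearAt K K' f ε ((extChartAt 𝓘(ℝ, E) p).symm y) ↔
      ∀ u, K'.JChart (f p) (chartRep f p y) (fderiv ℝ (chartRep f p) y u) =
        ε • fderiv ℝ (chartRep f p) y (K.JChart p y u) := by
  constructor
  · intro h u
    rw [JChart_chartRep hy, fderiv_chartRep_JChart hy, h, map_smul]
  · intro h v
    have h1 := h (chartDeriv p ((extChartAt 𝓘(ℝ, E) p).symm y) v)
    rw [JChart_chartRep hy, fderiv_chartRep_JChart hy, chartSymmDeriv_chartDeriv hy.1,
      ← map_smul] at h1
    have h2 := congrArg (chartSymmDeriv (f p) (chartRep f p y)) h1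
    rwa [← symm_chartRep hy, chartSymmDeriv_chartDeriv (chartRep_mem_target hy),
      chartSymmDeriv_chartDeriv (chartRep_mem_target hy), symm_chartRep hy] at h2

theorem isClosed_isComplexLinearAt (ε : ℝ) : IsClosed {p | IsComplexLinearAt K K' f ε p} := by
  refine isClosed_of_chart (f := f) (ι := E) (X := E) (fun p u y =>
    K'.JChart (f p) (chartRep f p y) (fderiv ℝ (chartRep f p) y u) -
        ε • fderiv ℝ (chartRep f p) y (K.JChart p y u)) (fun p u => ?_) (fun p y hy => ?_)
  · have hy := mem_chartRepDomain_self f p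
    have h1 := (contDiffAt_chartRep hy).continuousAt
    have h2 : ContinuousAt (fderiv ℝ (chartRep f p)) (extChartAt 𝓘(ℝ, E) p p) :=
      ((contDiffAt_chartRep hy).fderiv_right (m := ∞) (by simp)).continuousAt
    have h3 := (contDiffAt_JChart (K := K) hy.1).continuousAt
    have h4 := ((contDiffAt_JChart (K := K') (chartRep_mem_target hy)).continuousAt).comp h1
    exact (h4.clm_apply (h2.clm_apply continuousAt_const)).sub
      ((h2.clm_apply (h3.clm_apply continuousAt_const)).const_smul ε)
  · simp only [sub_eq_zero]
    exact isComplexLinearAt_iff_chart hy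

theorem not_isComplexLinearAt_both [Nontrivial E] {p : M} (h1 : IsComplexLinearAt K K' f 1 p)
    (h2 : IsComplexLinearAt K K' f (-1) p) : False := by
  obtain ⟨v, hv⟩ := exists_ne (0 : E)
  have h := (h1 v).symm.trans (h2 v)
  rw [one_smul, neg_one_smul, eq_neg_iff_add_eq_zero, ← two_smul ℝ] at h
  have h := (smul_eq_zero.1 h).resolve_left two_ne_zero
  have h3 : K.complexAt p v = 0 := (diffAt_bijective f p).1 (by rw [h, map_zero])
  have h4 := K.complexAt_sq p v
  rw [h3, map_zero] at h4
  exact hv (neg_eq_zero.1 h4.symm)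

/-- The sets belonging to the two signs are closed and complementary, hence clopen. -/
theorem exists_isComplexLinear [ConnectedSpace M] (hdim : 3 ≤ Module.finrank ℝ E)
    (hf : PreservesHolPlanes K K' f) :
    (∀ p, IsComplexLinearAt K K' f 1 p) ∨ ∀ p, IsComplexLinearAt K K' f (-1) p := by
  have : Nontrivial E := Module.nontrivial_of_finrank_pos (R := ℝ) (by omega)
  have hcompl : {p | IsComplexLinearAt K K' f 1 p} = {p | IsComplexLinearAt K K' f (-1) p}ᶜ := by
    ext p
    refine ⟨fun h1 h2 => not_isComplexLinearAt_both h1 h2, fun h => ?_⟩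
    exact (isComplexLinearAt_one_or_neg_one hdim hf p).resolve_right h
  have hclopen : IsClopen {p | IsComplexLinearAt K K' f 1 p} :=
    ⟨isClosed_isComplexLinearAt 1, hcompl ▸ (isClosed_isComplexLinearAt (-1)).isOpen_compl⟩
  rcases isClopen_iff.1 hclopen with h | h
  · right
    rw [hcompl, compl_empty_iff] at h
    exact fun p => (h ▸ mem_univ p : p ∈ {p | IsComplexLinearAt K K' f (-1) p})
  · left
    exact fun p => (h ▸ mem_univ p : p ∈ {p | IsComplexLinearAt K K' f 1 p})

/-! ### Conformality -/

/-- The pull-back of the metric of `K'` at `p`. -/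
def pullMetricAt (K' : IndefiniteKaehler E M') (f : M ≃ₘ^∞⟮𝓘(ℝ, E), 𝓘(ℝ, E)⟯ M') (p : M) :
    E →L[ℝ] E →L[ℝ] ℝ := (K'.metricAt (f p)).bilinearComp (diffAt f p) (diffAt f p)

theorem pullMetricAt_apply (p : M) (u v : E) :
    pullMetricAt K' f p u v = K'.metricAt (f p) (diffAt f p u) (diffAt f p v) := rfl

theorem gChart_chartRep {p : M} {y : E} (hy : y ∈ chartRepDomain f p) (u v : E) :
    K'.gChart (f p) (chartRep f p y) (fderiv ℝ (chartRep f p) y u)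
      (fderiv ℝ (chartRep f p) y v) =
      pullMetricAt K' f ((extChartAt 𝓘(ℝ, E) p).symm y) (chartSymmDeriv p y u)
        (chartSymmDeriv p y v) := by
  rw [gChart_apply, chartSymmDeriv_fderiv_chartRep hy, chartSymmDeriv_fderiv_chartRep hy,
    symm_chartRep hy]
  rfl

/-- The pull-back of the metric of `K'` is proportional to the metric of `K`. -/
def IsConformalAt (K : IndefiniteKaehler E M) (K' : IndefiniteKaehler E M')
    (f : M ≃ₘ^∞⟮𝓘(ℝ, E), 𝓘(ℝ, E)⟯ M') (p : M) : Prop :=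
  ∃ c : ℝ, ∀ u v : E, pullMetricAt K' f p u v = c * K.metricAt p u v

/-- Eliminating the unknown factor by cross multiplication leaves equations between continuous
functions, which is what closedness requires. -/
theorem isConformalAt_iff (p : M) : IsConformalAt K K' f p ↔ ∀ i : E × E × E × E,
    pullMetricAt K' f p i.1 i.2.1 * K.metricAt p i.2.2.1 i.2.2.2 =
      pullMetricAt K' f p i.2.2.1 i.2.2.2 * K.metricAt p i.1 i.2.1 := by
  constructor
  · rintro ⟨c, hc⟩ i
    rw [hc, hc]
    ring
  · intro h
    obtain ⟨a, ha⟩ := (K.metricAt_indefinite p).1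
    refine ⟨pullMetricAt K' f p a a / K.metricAt p a a, fun u v => ?_⟩
    have := h (u, v, a, a)
    field_simp
    exact this

theorem isClosed_isConformalAt : IsClosed {p | IsConformalAt K K' f p} := by
  refine isClosed_of_chart (f := f) (ι := E × E × E × E) (X := ℝ) (fun p i y =>
    K'.gChart (f p) (chartRep f p y) (fderiv ℝ (chartRep f p) y i.1)
      (fderiv ℝ (chartRep f p) y i.2.1) * K.gChart p y i.2.2.1 i.2.2.2 -
    K'.gChart (f p) (chartRep f p y) (fderiv ℝ (chartRep f p) y i.2.2.1)
      (fderiv ℝ (chartRep f p) y i.2.2.2) * K.gChart p y i.1 i.2.1)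
    (fun p u => ?_) (fun p y hy => ?_)
  · have hy := mem_chartRepDomain_self f p
    have h1 := (contDiffAt_chartRep hy).continuousAt
    have h2 : ContinuousAt (fderiv ℝ (chartRep f p)) (extChartAt 𝓘(ℝ, E) p p) :=
      ((contDiffAt_chartRep hy).fderiv_right (m := ∞) (by simp)).continuousAt
    have h3 := (isSmoothMetricAt_gChart (K := K) hy.1).contDiffAt.continuousAt
    have h4 := ((isSmoothMetricAt_gChart (K := K')
      (chartRep_mem_target hy)).contDiffAt.continuousAt).comp h1
    have h5 : ∀ a b, ContinuousAt (fun y => K'.gChart (f p) (chartRep f p y)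
        (fderiv ℝ (chartRep f p) y a) (fderiv ℝ (chartRep f p) y b))
        (extChartAt 𝓘(ℝ, E) p p) := fun a b =>
      (h4.clm_apply (h2.clm_apply continuousAt_const)).clm_apply (h2.clm_apply continuousAt_const)
    have h6 : ∀ a b, ContinuousAt (fun y => K.gChart p y a b) (extChartAt 𝓘(ℝ, E) p p) :=
      fun a b => (h3.clm_apply continuousAt_const).clm_apply continuousAt_const
    exact ((h5 _ _).mul (h6 _ _)).sub ((h5 _ _).mul (h6 _ _))
  · simp only [sub_eq_zero, gChart_chartRep hy, gChart_apply]
    rw [mem_ofPred_eq, isConformalAt_iff]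
    refine ⟨fun h i => h (_, _, _, _), fun h i => ?_⟩
    have := h (chartDeriv p ((extChartAt 𝓘(ℝ, E) p).symm y) i.1,
      chartDeriv p ((extChartAt 𝓘(ℝ, E) p).symm y) i.2.1,
      chartDeriv p ((extChartAt 𝓘(ℝ, E) p).symm y) i.2.2.1,
      chartDeriv p ((extChartAt 𝓘(ℝ, E) p).symm y) i.2.2.2)
    simpa only [chartSymmDeriv_chartDeriv hy.1] using this

/-- The sign enters the curvature through two arguments, so it appears only as `ε ^ 2`. -/
theorem holSectional_push_eq {ε : ℝ} (hε : ε ^ 2 = 1) {p : M}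
    (h : IsComplexLinearAt K K' f ε p) (x : E) :
    K'.holSectional (f p) (diffAt f p x) =
      K'.R (f p) (diffAt f p x) (diffAt f p (K.complexAt p x)) (diffAt f p (K.complexAt p x))
        (diffAt f p x) / pullMetricAt K' f p x x ^ 2 := by
  have key : K'.R (f p) (diffAt f p x) (ε • diffAt f p (K.complexAt p x))
      (ε • diffAt f p (K.complexAt p x)) (diffAt f p x) =
      ε ^ 2 * K'.R (f p) (diffAt f p x) (diffAt f p (K.complexAt p x))
        (diffAt f p (K.complexAt p x)) (diffAt f p x) := by
    simp only [R_eq, map_add, map_sub, map_smul, add_apply, sub_apply, smul_apply, smul_eq_mul]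
    ring
  rw [holSectional_eq, h, key, hε, one_mul, pullMetricAt_apply]

theorem isConformalAt_of_ratio (hdim : 3 ≤ Module.finrank ℝ E) {p : M}
    (hratio : ∀ ξ : TangentSpace 𝓘(ℝ, E) p,
      K.IsIsotropic p ξ → HolCurvatureRatioTendsToOne K K' f p ξ)
    (hnonconst : ¬ K.HasConstHolSectionalAt p) : IsConformalAt K K' f p := by
  have hk : Continuous fun x : E => K'.R (f p) (diffAt f p x)
      (K'.complexAt (f p) (diffAt f p x)) (K'.complexAt (f p) (diffAt f p x)) (diffAt f p x) :=
    (K'.continuous_R (f p)).comp (diffAt f p).continuous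
  rcases eq_const_or_conformal_of_ratio hdim (K.metricAt_symm p)
    (h := pullMetricAt K' f p) (fun x y => K'.metricAt_symm _ _ _) (K.metricAt_nondeg p)
    (K.metricAt_indefinite p) (K.isQuadrilinear_R p) (K.continuous_R p) hk
    (fun ξ hξ0 hξ => by
      have h := hratio ξ ⟨hξ0, hξ⟩
      have h1 : Tendsto (fun x : E => K'.holSectional (f p) (diffAt f p x) / K.holSectional p x)
        (𝓝[{x : E | K.metricAt p x x ≠ 0 ∧ pullMetricAt K' f p x x ≠ 0 ∧
          K.holSectional p x ≠ 0}] ξ) (𝓝 1) := h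
      simpa only [holSectional_eq, pullMetricAt_apply] using h1) with ⟨c, hc⟩ | h
  · refine absurd ⟨c, fun x hx => ?_⟩ hnonconst
    have hx' : K.metricAt p x x ≠ 0 := hx
    refine (K.holSectional_eq p x).trans ?_
    rw [hc x]
    field_simp
  · exact h

/-! ### The conformal factor is constant -/

theorem conformalFactor_ne_zero [Nontrivial E] {p : M} {c : ℝ}
    (h : ∀ u v : E, pullMetricAt K' f p u v = c * K.metricAt p u v) : c ≠ 0 := by
  rintro rfl
  obtain ⟨v, hv⟩ := exists_ne (0 : E)
  refine hv ((diffAt_bijective f p).1 ((K'.metricAt_nondeg (f p) _ fun w => ?_).trans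
    (map_zero _).symm))
  obtain ⟨w, rfl⟩ := (diffAt_bijective f p).2 w
  simpa [pullMetricAt_apply] using h v w

theorem eventually_isSmoothMetricAt {p : M} {y : E} (hy : y ∈ (extChartAt 𝓘(ℝ, E) p).target) :
    ∀ᶠ z in 𝓝 y, IsSmoothMetricAt (K.gChart p) z := by
  filter_upwards [(isOpen_extChartAt_target p).mem_nhds hy] with z hz
  exact isSmoothMetricAt_gChart hz

theorem conformalFactor_eventually_eq (hdim : 3 ≤ Module.finrank ℝ E) {ε : ℝ} (hε : ε ≠ 0)
    (hcl : ∀ p, IsComplexLinearAt K K' f ε p) {c : M → ℝ}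
    (hc : ∀ p, ∀ u v : E, pullMetricAt K' f p u v = c p * K.metricAt p u v) (p : M) :
    ∀ᶠ q in 𝓝 p, c q = c p := by
  have : Nontrivial E := Module.nontrivial_of_finrank_pos (R := ℝ) (by omega)
  have hself := mem_chartRepDomain_self f p
  obtain ⟨a, ha⟩ := (K.metricAt_indefinite p).1
  have ha' : K.gChart p (extChartAt 𝓘(ℝ, E) p p) a a ≠ 0 := by rw [gChart_self]; exact ha.ne'
  set s : E → ℝ := fun z => K'.gChart (f p) (chartRep f p z) (fderiv ℝ (chartRep f p) z a)
    (fderiv ℝ (chartRep f p) z a)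
  -- No regularity of `c` is assumed. Evaluating both metrics on a fixed vector `a`, non-null near
  -- the centre, gives a smooth function which equals `c` in the chart.
  set r : E → ℝ := fun z => s z * (K.gChart p z a a)⁻¹ with hr
  have hcont : ContinuousAt (fun z => K.gChart p z a a) (extChartAt 𝓘(ℝ, E) p p) :=
    (((isSmoothMetricAt_gChart (K := K) hself.1).contDiffAt.continuousAt).clm_apply
      continuousAt_const).clm_apply continuousAt_const
  obtain ⟨δ, hδ, hball⟩ := Metric.eventually_nhds_iff_ball.1
    ((hcont.eventually_ne ha').and ((isOpen_chartRepDomain f p).mem_nhds hself))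
  set B := Metric.ball (extChartAt 𝓘(ℝ, E) p p) δ
  have hrel : ∀ z ∈ chartRepDomain f p, ∀ u v, K'.gChart (f p) (chartRep f p z)
      (fderiv ℝ (chartRep f p) z u) (fderiv ℝ (chartRep f p) z v) =
        c ((extChartAt 𝓘(ℝ, E) p).symm z) * K.gChart p z u v := by
    intro z hz u v
    rw [gChart_chartRep hz, hc, gChart_apply]
  have hrc : ∀ z ∈ B, r z = c ((extChartAt 𝓘(ℝ, E) p).symm z) := by
    intro z hz
    simp only [hr, s]
    rw [hrel z (hball z hz).2]
    exact mul_inv_cancel_right₀ (hball z hz).1 _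
  have hsmooth : ∀ z ∈ B, ContDiffAt ℝ ∞ r z := by
    intro z hz
    have hd := (hball z hz).2
    have h1 := contDiffAt_chartRep hd
    have h2 := (contDiffAt_chartRep hd).fderiv_right (m := ∞) (by simp)
    have h3 := (isSmoothMetricAt_gChart (K := K) hd.1).contDiffAt
    have h4 := ((isSmoothMetricAt_gChart (K := K') (chartRep_mem_target hd)).contDiffAt).comp z h1
    exact ((h4.clm_apply (h2.clm_apply contDiffAt_const)).clm_apply
      (h2.clm_apply contDiffAt_const)).mul
        (((h3.clm_apply contDiffAt_const).clm_apply contDiffAt_const).inv (hball z hz).1)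
  have hderiv : ∀ z ∈ B, fderiv ℝ r z = 0 := by
    intro z hz
    have hd := (hball z hz).2
    have hG := isSmoothMetricAt_gChart (K := K) hd.1
    have hr0 : r z ≠ 0 := by rw [hrc z hz]; exact conformalFactor_ne_zero (hc _)
    refine fderiv_eq_zero_of_conformal hdim hG (hsmooth z hz) hr0 (J := K.JChart p)
      (JChart_sq hd.1) (gChart_JChart hd.1) (K.J_parallel p z hd.1) ?_
    have hpull : IsPullbackNear (fun z => r z • K.gChart p z) (K'.gChart (f p)) (chartRep f p) z := by
      filter_upwards [Metric.isOpen_ball.mem_nhds hz] with w hw u v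
      rw [hrel w (hball w hw).2, ← hrc w hw]
      rfl
    refine covDerivEnd_pullback hε (hG.smul (hsmooth z hz) hr0)
      (isSmoothMetricAt_gChart (chartRep_mem_target hd)) (contDiffAt_chartRep hd)
      (fderiv_chartRep_bijective hd) hpull ((contDiffAt_JChart hd.1).differentiableAt (by simp))
      ((contDiffAt_JChart (chartRep_mem_target hd)).differentiableAt (by simp)) ?_
      (K'.J_parallel (f p) _ (chartRep_mem_target hd))
    filter_upwards [(isOpen_chartRepDomain f p).mem_nhds hd] with w hw
    exact (isComplexLinearAt_iff_chart hw).1 (hcl _)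
  have hev : ∀ᶠ q in 𝓝 p, extChartAt 𝓘(ℝ, E) p q ∈ B :=
    (continuousAt_extChartAt (I := 𝓘(ℝ, E)) p).eventually (Metric.ball_mem_nhds _ hδ)
  have hp : extChartAt 𝓘(ℝ, E) p p ∈ B := Metric.mem_ball_self hδ
  filter_upwards [hev, extChartAt_source_mem_nhds (I := 𝓘(ℝ, E)) p] with q hq hqs
  -- A ball is used because it is connected: zero derivative then gives constancy.
  have heq := Metric.isOpen_ball.is_const_of_fderiv_eq_zero
    (convex_ball _ δ).isPreconnected
    (fun z hz => ((hsmooth z hz).differentiableAt (by simp)).differentiableWithinAt)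
    (fun z hz => hderiv z hz) hq hp
  rwa [hrc _ hq, hrc _ hp, (extChartAt 𝓘(ℝ, E) p).left_inv hqs, extChartAt_to_inv] at heq

theorem conformalFactor_const [ConnectedSpace M] (hdim : 3 ≤ Module.finrank ℝ E) {ε : ℝ}
    (hε : ε ≠ 0) (hcl : ∀ p, IsComplexLinearAt K K' f ε p) (hconf : ∀ p, IsConformalAt K K' f p) :
    ∃ c : ℝ, ∀ p, ∀ u v : E, pullMetricAt K' f p u v = c * K.metricAt p u v := by
  choose c hc using hconf
  have hloc : IsLocallyConstant c :=
    (IsLocallyConstant.iff_eventually_eq c).2 (conformalFactor_eventually_eq hdim hε hcl hc)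
  obtain ⟨p₀⟩ : Nonempty M := inferInstance
  refine ⟨c p₀, fun p u v => ?_⟩
  rw [hc, hloc.apply_eq_of_preconnectedSpace p p₀]

/-! ### Homotheties and the value of the constant. -/

theorem R_push {c : ℝ} (hc0 : c ≠ 0)
    (hc : ∀ p, ∀ u v : E, pullMetricAt K' f p u v = c * K.metricAt p u v) (p : M) (x y z u : E) :
    K'.R (f p) (diffAt f p x) (diffAt f p y) (diffAt f p z) (diffAt f p u) =
      c * K.R p x y z u := by
  have hself := mem_chartRepDomain_self f p
  have hdom := (isOpen_chartRepDomain f p).mem_nhds hself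
  have hG := eventually_isSmoothMetricAt (K := K) hself.1
  have hG' := eventually_isSmoothMetricAt (K := K') (chartRep_mem_target hself)
  have hpull : IsPullbackNear (fun z => c • K.gChart p z) (K'.gChart (f p)) (chartRep f p)
      (extChartAt 𝓘(ℝ, E) p p) := by
    filter_upwards [hdom] with w hw u v
    rw [gChart_chartRep hw, hc]
    rfl
  have h := curvature_pullback (hG.mono fun z hz => hz.smul contDiffAt_const hc0) hG'
    (by filter_upwards [hdom] with w hw using contDiffAt_chartRep hw)
    (by filter_upwards [hdom] with w hw using (fderiv_chartRep_bijective hw).2) hpull x y z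
  rw [curvature_smul_const c hc0 hG, fderiv_chartRep_self, chartRep_self] at h
  change K'.metricAt (f p) (curvature (K'.gChart (f p)) (extChartAt 𝓘(ℝ, E) (f p) (f p))
    (diffAt f p x) (diffAt f p y) (diffAt f p z)) (diffAt f p u) = _
  rw [← h, ← pullMetricAt_apply, hc]
  rfl

theorem conformalFactor_eq_one {ε : ℝ} (hε : ε ^ 2 = 1) {p : M}
    (hcl : IsComplexLinearAt K K' f ε p) {c : ℝ} (hc0 : c ≠ 0)
    (hc : ∀ p, ∀ u v : E, pullMetricAt K' f p u v = c * K.metricAt p u v)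
    (hratio : ∀ ξ : TangentSpace 𝓘(ℝ, E) p,
      K.IsIsotropic p ξ → HolCurvatureRatioTendsToOne K K' f p ξ)
    (hnonconst : ¬ K.HasConstHolSectionalAt p) : c = 1 := by
  obtain ⟨ξ, hξ0, hξ⟩ := exists_null (K.metricAt_symm p) (K.metricAt_indefinite p)
  have h : Tendsto (fun x : E => K'.holSectional (f p) (diffAt f p x) / K.holSectional p x)
    (𝓝[{x : E | K.metricAt p x x ≠ 0 ∧ pullMetricAt K' f p x x ≠ 0 ∧
      K.holSectional p x ≠ 0}] ξ) (𝓝 1) := hratio ξ ⟨hξ0, hξ⟩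
  obtain ⟨x, hgx, hx⟩ : ∃ x : E, K.metricAt p x x ≠ 0 ∧ K.holSectional p x ≠ 0 := by
    by_contra hcon
    push Not at hcon
    exact hnonconst ⟨0, hcon⟩
  -- The limit carries information only if admissible vectors accumulate at `ξ`. They contain the
  -- non-vanishing set of `g(x, x) R(x, Jx, Jx, x)`, which is dense since this polynomial is not
  -- identically zero.
  have hpoly := (PolynomialOnLines.of_bilin (K.metricAt p)).mul
    (K.isQuadrilinear_R p).polynomialOnLines
  rw [holSectional_eq] at hx
  have hdense := hpoly.dense (mul_ne_zero hgx (div_ne_zero_iff.1 hx).1)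
  have hne : (𝓝[{x : E | K.metricAt p x x ≠ 0 ∧ pullMetricAt K' f p x x ≠ 0 ∧
      K.holSectional p x ≠ 0}] ξ).NeBot := by
    rw [← mem_closure_iff_nhdsWithin_neBot]
    refine closure_mono (fun z hz => ?_) (hdense ξ)
    obtain ⟨h1, h2⟩ := mul_ne_zero_iff.1 hz
    refine ⟨h1, ?_, ?_⟩
    · rw [hc]
      exact mul_ne_zero hc0 h1
    · rw [holSectional_eq]
      exact div_ne_zero h2 (pow_ne_zero 2 h1)
  have hconst : Tendsto (fun _ : E => c⁻¹)
      (𝓝[{x : E | K.metricAt p x x ≠ 0 ∧ pullMetricAt K' f p x x ≠ 0 ∧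
      K.holSectional p x ≠ 0}] ξ) (𝓝 1) := by
    refine h.congr' ?_
    filter_upwards [self_mem_nhdsWithin] with z hz
    obtain ⟨h1, -, h3⟩ := hz
    rw [holSectional_eq] at h3
    have h4 := (div_ne_zero_iff.1 h3).1
    rw [holSectional_push_eq hε hcl, holSectional_eq, R_push hc0 hc, hc]
    field_simp
  have := tendsto_nhds_unique hconst tendsto_const_nhds
  exact inv_eq_one.1 this.symm

end Main

end

/-! ### Assembly of the theorem. -/

theorem mainTheorem3 (n : ℕ) (hn : 2 ≤ n)
    {M : Type*} [TopologicalSpace M] [ChartedSpace (EuclideanSpace ℝ (Fin (2 * n))) M]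
    [IsManifold 𝓘(ℝ, EuclideanSpace ℝ (Fin (2 * n))) ∞ M] [ConnectedSpace M]
    {M' : Type*} [TopologicalSpace M'] [ChartedSpace (EuclideanSpace ℝ (Fin (2 * n))) M']
    [IsManifold 𝓘(ℝ, EuclideanSpace ℝ (Fin (2 * n))) ∞ M']
    (K : IndefiniteKaehler (EuclideanSpace ℝ (Fin (2 * n))) M)
    (K' : IndefiniteKaehler (EuclideanSpace ℝ (Fin (2 * n))) M')
    (f : M ≃ₘ^∞⟮𝓘(ℝ, EuclideanSpace ℝ (Fin (2 * n))), 𝓘(ℝ, EuclideanSpace ℝ (Fin (2 * n)))⟯ M')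
    (hplanes : PreservesHolPlanes K K' f)
    (hratio : ∀ (p : M) (ξ : TangentSpace 𝓘(ℝ, EuclideanSpace ℝ (Fin (2 * n))) p),
      K.IsIsotropic p ξ → HolCurvatureRatioTendsToOne K K' f p ξ)
    (hnonconst : Dense {p : M | ¬ K.HasConstHolSectionalAt p})
    (hbochner : ∃ (p : M) (x y z u : TangentSpace 𝓘(ℝ, EuclideanSpace ℝ (Fin (2 * n))) p),
      K.bochner p x y z u ≠ 0) :
    (IsHolomorphicMap K K' f ∨ IsAntiholomorphicMap K K' f) ∧ PreservesMetric K K' f := by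
  have hdim : 3 ≤ Module.finrank ℝ (EuclideanSpace ℝ (Fin (2 * n))) := by
    rw [finrank_euclideanSpace_fin]
    omega
  have : Nontrivial (EuclideanSpace ℝ (Fin (2 * n))) :=
    Module.nontrivial_of_finrank_pos (R := ℝ) (by omega)
  -- Conformality is available on the dense set of points with non-constant curvature and passes to
  -- its closure. One such point also serves below to evaluate the constant.
  have hconf : ∀ p, IsConformalAt K K' f p := fun p =>
    (isClosed_isConformalAt (K := K) (K' := K') (f := f)).closure_subset_iff.2
      (fun q hq => isConformalAt_of_ratio hdim (hratio q) hq) (hnonconst p)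
  obtain ⟨p, hp⟩ := hnonconst.nonempty
  have hmetric : ∀ ε : ℝ, ε ^ 2 = 1 → (∀ q, IsComplexLinearAt K K' f ε q) →
      PreservesMetric K K' f := by
    intro ε hε hcl
    obtain ⟨c, hc⟩ := conformalFactor_const hdim (by rintro rfl; norm_num at hε) hcl hconf
    have hc1 := conformalFactor_eq_one hε (hcl p) (conformalFactor_ne_zero (hc p)) hc (hratio p) hp
    intro q x y
    have h := hc q x y
    rw [hc1, one_mul] at h
    exact h
  rcases exists_isComplexLinear hdim hplanes with h | h
  · refine ⟨Or.inl fun q x => ?_, hmetric 1 (by norm_num) h⟩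
    have h1 := h q x
    rw [one_smul] at h1
    exact h1.symm
  · refine ⟨Or.inr fun q x => ?_, hmetric (-1) (by norm_num) h⟩
    have h1 := h q x
    rw [neg_one_smul] at h1
    exact neg_eq_iff_eq_neg.1 h1.symm
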